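/- Let $G$ be a countable Abelian group (written additively), and let $(F_n)_{n\ge 0}$, $(C_n)_{n\ge 1}$ be finite subsets of $G$ with $F_0=\{0\}$, $\#C_n>1$ for $n\ge1$, $F_n+C_{n+1}\subset F_{n+1}$ and $(F_n+c)\cap(F_n+c')=\emptyset$ for all $n\ge 0$ and all $c\ne c'$ in $C_{n+1}$. Let $X$ be the topological inductive limit of the compact spaces $X_n=F_n\times C_{n+1}\times C_{n+2}\times\cdots$ along the embeddings $X_n\ni(f,c_{n+1},c_{n+2},\dots)\mapsto(f+c_{n+1},c_{n+2},\dots)\in X_{n+1}$, and put $[A]_n=\{(f,c_{n+1},\dots)\in X_n: f\in A\}$ and $[f]_n=[\{f\}]_n$. Let $\mu$ be the $\sigma$-finite Borel measure on $X$ whose restriction to each $X_n$ is $(\#C_1\cdots\#C_n)^{-1}$ times the product of the counting measure on $F_n$ and the uniform probability measures on $C_{n+1},C_{n+2},\dots$ (so $\mu([0]_0)=1$). For $g\in G$ let $X^g=\bigcup_n\{(f,c_{n+1},\dots)\in X_n: g+f\in F_n\}$, let $X^G=\bigcap_{g\in G}X^g$, and let $T=(T_g)_{g\in G}$ be the action of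 $G$ on $X^G$ given by $T_g(f,c_{n+1},c_{n+2},\dots)=(g+f,c_{n+1},c_{n+2},\dots)$ for any representation in some $X_n$ with $f,\,g+f\in F_n$; for $B\subset X$ write $T_gB$ for $T_g(B\cap X^G)$. Assume that $T$ is defined almost everywhere, in the sense that for all $g\in G$ and $n>0$, $$\lim_{m\to\infty}\frac{\#\big((g+F_n+C_{n+1}+\cdots+C_m)\cap F_m\big)}{\#F_n\,\#C_{n+1}\cdots\#C_m}=1 .$$ Suppose moreover that the "large holes" condition holds: for every $g\in G$, for all sufficiently large $n$, $$(g+F_n+F_n-F_n-F_n)\cap(C_{n+1}-C_{n+1})=\{0\}.$$ Then for all Borel sets $A,B\subset[0]_0$, $$\lim_{n\to\infty}\frac{\sum_{g\in F_n-F_n}\mu(A\cap T_gB)}{\sum_{g\in F_n-F_n}\mu([0]_0\cap T_g[0]_0)}=\mu(A)\mu(B).$$ Thus $T$ is weakly rationally ergodic along the increasing sequence $D_n=F_n-F_n$, that is: $T$ is a measure preserving, ergodic and conservative action on the $\sigma$-finite space $(X^G,\mu)$, and there is a measurable set $Y$ with $0<\mu(Y)<\infty$ such that, with $a_n(Y)=\sum_{g\in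 D_n}\mu(Y\cap T_gY)/\mu(Y)^2$, $$\lim_{n\to\infty}\frac1{a_n(Y)}\sum_{g\in D_n}\mu(A\cap T_gB)=\mu(A)\mu(B)\quad\text{for all measurable }A,B\subset Y.$$ -/

import Mathlib

open MeasureTheory Filter Topology
open scoped Pointwise ENNReal

/-- A `(C,F)`-sequence in an Abelian group: finite sets `F 0, F 1, …` and `C 1, C 2, …` with
`F 0 = {0}`, `#(C n) > 1`, `F n + C (n+1) ⊆ F (n+1)`, and the translates `F n + c`,
`c ∈ C (n+1)`, pairwise disjoint. The value `C 0` is never used. -/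
structure CFSequence (G : Type*) [AddCommGroup G] where
  F : ℕ → Finset G
  C : ℕ → Finset G
  F_zero : F 0 = {0}
  one_lt_card : ∀ n, 0 < n → 1 < (C n).card
  add_mem : ∀ n, ∀ f ∈ F n, ∀ c ∈ C (n + 1), f + c ∈ F (n + 1)
  disjoint_translates : ∀ n, ∀ c ∈ C (n + 1), ∀ c' ∈ C (n + 1), c ≠ c' →
    Disjoint ((fun f => f + c) '' (F n : Set G)) ((fun f => f + c') '' (F n : Set G))

/-- A finite subset of a group as a finite discrete (topological and measurable) space. -/
def Letter {G : Type*} (A : Finset G) : Type _ := {g : G // g ∈ A}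

namespace Letter

variable {G : Type*} (A : Finset G)

instance : Finite (Letter A) := inferInstanceAs (Finite {g : G // g ∈ A})

instance : TopologicalSpace (Letter A) := ⊥

instance : DiscreteTopology (Letter A) := ⟨rfl⟩

instance : MeasurableSpace (Letter A) := ⊤

end Letter

namespace CFSequence

variable {G : Type*} [AddCommGroup G] (S : CFSequence G)

/-- The space `X_n = F_n × C_{n+1} × C_{n+2} × ⋯`, with the product topology and the product
`σ`-algebra. -/
abbrev Level (n : ℕ) : Type _ := Letter (S.F n) × ((j : Set.Ioi n) → Letter (S.C j))

/-- The embedding `(f, c_{n+1}, c_{n+2}, …) ↦ (f + c_{n+1}, c_{n+2}, …)` of `X_n` in `X_{n+1}`. -/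
def step (n : ℕ) (x : S.Level n) : S.Level (n + 1) :=
  (⟨x.1.1 + (x.2 ⟨n + 1, Nat.lt_succ_self n⟩).1, S.add_mem n _ x.1.2 _ (x.2 _).2⟩,
    fun j => x.2 ⟨j.1, Nat.lt_of_succ_lt j.2⟩)

/-- The identifications made in the inductive limit: `x ∈ X_n` is glued to its image in `X_{n+1}`. -/
inductive Glue : (Σ n, S.Level n) → (Σ n, S.Level n) → Prop
  | step (n : ℕ) (x : S.Level n) : Glue ⟨n, x⟩ ⟨n + 1, S.step n x⟩

/-- The `(C,F)`-space: the topological inductive limit of `X_0 → X_1 → X_2 → ⋯`. -/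
def Space : Type _ := Quot S.Glue

/-- The inductive limit topology. -/
instance : TopologicalSpace S.Space := inferInstanceAs (TopologicalSpace (Quot S.Glue))

instance : MeasurableSpace S.Space := borel _

instance : BorelSpace S.Space := ⟨rfl⟩

/-- The canonical map of `X_n` to the `(C,F)`-space. -/
def incl (n : ℕ) (x : S.Level n) : S.Space := Quot.mk _ ⟨n, x⟩

/-- The cylinder `[A]_n = {(f, c_{n+1}, …) ∈ X_n | f ∈ A}`, as a subset of the `(C,F)`-space. -/
def cylinder (n : ℕ) (A : Set G) : Set S.Space := S.incl n '' {x | x.1.1 ∈ A}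

/-! ### The invariant measure -/

/-- The measure on `X_n` that is the product of the counting measure on `F_n` and of the uniform
probabilities on `C_{n+1}, C_{n+2}, …`, divided by `#C_1 ⋯ #C_n`. -/
noncomputable def levelMeasure (n : ℕ) : Measure (S.Level n) :=
  (∏ j ∈ Finset.Icc 1 n, ((S.C j).card : ℝ≥0∞))⁻¹ •
    (Measure.count.prod
      (Measure.infinitePi fun j : Set.Ioi n =>
        (ProbabilityTheory.uniformOn Set.univ : Measure (Letter (S.C j)))))

/-- The `(C,F)`-measure. These measures on `X_0 ⊆ X_1 ⊆ ⋯` extend one another, so that the measure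
on their union is given on `X_n ∖ X_{n-1}` by the one on `X_n`. -/
noncomputable def measure : Measure S.Space :=
  Measure.sum fun n =>
    ((S.levelMeasure n).map (S.incl n)).restrict (disjointed (fun k => Set.range (S.incl k)) n)

/-! ### The action -/

/-- `(f, c_{n+1}, …) ↦ (g + f, c_{n+1}, …)`, when `g + f` is in `F_n`. -/
def shift {S : CFSequence G} {n : ℕ} (g : G) (x : S.Level n) (h : g + x.1.1 ∈ S.F n) : S.Level n :=
  (⟨g + x.1.1, h⟩, x.2)

/-- The set `X^g`: the union over `n` of `{(f, c_{n+1}, …) ∈ X_n | g + f ∈ F_n}`. -/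
def domain (g : G) : Set S.Space :=
  {p | ∃ (n : ℕ) (x : S.Level n), g + x.1.1 ∈ S.F n ∧ S.incl n x = p}

/-- The set `X^G`, the intersection of all `X^g`. -/
def fullDomain : Set S.Space := ⋂ g, S.domain g

theorem incl_step (n : ℕ) (x : S.Level n) : S.incl (n + 1) (S.step n x) = S.incl n x :=
  (Quot.sound (Glue.step n x)).symm

theorem shift_step {n : ℕ} (g : G) (x : S.Level n) (h : g + x.1.1 ∈ S.F n) :
    ∃ h' : g + (S.step n x).1.1 ∈ S.F (n + 1), shift g (S.step n x) h' = S.step n (shift g x h) := by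
  have e : g + (S.step n x).1.1 = (S.step n (shift g x h)).1.1 := (add_assoc _ _ _).symm
  refine ⟨e ▸ (S.step n (shift g x h)).1.2, ?_⟩
  exact Prod.ext (Subtype.ext e) rfl

theorem exists_level_of_le {n N : ℕ} (hN : n ≤ N) (g : G) (x : S.Level n)
    (h : g + x.1.1 ∈ S.F n) :
    ∃ (y : S.Level N) (h' : g + y.1.1 ∈ S.F N),
      S.incl N y = S.incl n x ∧ S.incl N (shift g y h') = S.incl n (shift g x h) := by
  induction N, hN using Nat.le_induction with
  | base => exact ⟨x, h, rfl, rfl⟩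
  | succ N _ ih =>
    obtain ⟨y, hy, e₁, e₂⟩ := ih
    obtain ⟨h', e⟩ := S.shift_step g y hy
    exact ⟨S.step N y, h', by rw [incl_step, e₁], by rw [e, incl_step, e₂]⟩

/-- The coordinate in `F_m` of a point of `X_n` (for `m ≥ n`), after embedding it in `X_m`. -/
def address (p : Σ n, S.Level n) (m : ℕ) : G :=
  p.2.1.1 + ∑ j ∈ Finset.Ioc p.1 m, if h : p.1 < j then (p.2.2 ⟨j, h⟩).1 else 0

theorem address_self (n : ℕ) (x : S.Level n) : S.address ⟨n, x⟩ n = x.1.1 := by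
  simp [address]

theorem address_succ {n m : ℕ} (x : S.Level n) (h : n ≤ m) :
    S.address ⟨n, x⟩ (m + 1) = S.address ⟨n, x⟩ m + (x.2 ⟨m + 1, Nat.lt_succ_of_le h⟩).1 := by
  have h' : n < m + 1 := Nat.lt_succ_of_le h
  simp only [address]
  rw [Finset.sum_Ioc_succ_top h, dif_pos h', add_assoc]

theorem address_mem {n m : ℕ} (x : S.Level n) (h : n ≤ m) : S.address ⟨n, x⟩ m ∈ S.F m := by
  induction m, h using Nat.le_induction with
  | base => rw [address_self]; exact x.1.2
  | succ m h ih => rw [address_succ S x h]; exact S.add_mem m _ ih _ (x.2 _).2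

theorem address_step (n : ℕ) (x : S.Level n) {m : ℕ} (h : n + 1 ≤ m) :
    S.address ⟨n + 1, S.step n x⟩ m = S.address ⟨n, x⟩ m := by
  induction m, h using Nat.le_induction with
  | base => rw [address_self, address_succ S x le_rfl, address_self]; rfl
  | succ m h ih =>
    rw [address_succ S _ h, address_succ S x (Nat.le_of_succ_le h), ih]; rfl

/-- A point of the `(C,F)`-space determines its coordinates in `F_m` for all large `m`. -/
def germ : S.Space → (atTop : Filter ℕ).Germ G :=
  Quot.lift (fun p => (S.address p : (atTop : Filter ℕ).Germ G)) (by
    rintro _ _ ⟨n, x⟩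
    refine Filter.Germ.coe_eq.2 ?_
    filter_upwards [eventually_ge_atTop (n + 1)] with m hm
    exact (S.address_step n x hm).symm)

theorem incl_injective (n : ℕ) : Function.Injective (S.incl n) := by
  intro x y hxy
  have hg : (S.address ⟨n, x⟩ : (atTop : Filter ℕ).Germ G) = S.address ⟨n, y⟩ :=
    congrArg S.germ hxy
  obtain ⟨M, hM⟩ := eventually_atTop.1 (Filter.Germ.coe_eq.1 hg)
  have key : ∀ m (h : n ≤ m), S.address ⟨n, x⟩ (m + 1) = S.address ⟨n, y⟩ (m + 1) →
      x.2 ⟨m + 1, Nat.lt_succ_of_le h⟩ = y.2 ⟨m + 1, Nat.lt_succ_of_le h⟩ ∧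
        S.address ⟨n, x⟩ m = S.address ⟨n, y⟩ m := by
    intro m h e
    rw [address_succ S x h, address_succ S y h] at e
    have hc : (x.2 ⟨m + 1, Nat.lt_succ_of_le h⟩).1 = (y.2 ⟨m + 1, Nat.lt_succ_of_le h⟩).1 := by
      by_contra hne
      exact Set.disjoint_left.1 (S.disjoint_translates m _ (x.2 _).2 _ (y.2 _).2 hne)
        ⟨_, S.address_mem x h, rfl⟩ ⟨_, S.address_mem y h, e.symm⟩
    rw [hc] at e
    exact ⟨Subtype.ext hc, add_right_cancel e⟩
  have down : ∀ k m, n ≤ m → S.address ⟨n, x⟩ (m + k) = S.address ⟨n, y⟩ (m + k) →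
      S.address ⟨n, x⟩ m = S.address ⟨n, y⟩ m := by
    intro k
    induction k with
    | zero => exact fun m _ e => e
    | succ k ih =>
      intro m h e
      exact ih m h (key (m + k) (by omega) e).2
  have all : ∀ m, n ≤ m → S.address ⟨n, x⟩ m = S.address ⟨n, y⟩ m :=
    fun m h => down M m h (hM _ (by omega))
  refine Prod.ext (Subtype.ext ?_) (funext ?_)
  · have e := all n le_rfl
    rwa [address_self, address_self] at e
  · rintro ⟨j, hj⟩
    obtain ⟨m, rfl⟩ : ∃ m, j = m + 1 := ⟨j - 1, by have : n < j := hj; omega⟩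
    have hm : n ≤ m := Nat.le_of_lt_succ hj
    exact (key m hm (all (m + 1) (by omega))).1

/-- The value at a point of `X^g` of the partial transformation `T_g` of the `(C,F)`-space does not
depend on the representation of the point. -/
theorem shift_unique {n m : ℕ} (g : G) (x : S.Level n) (y : S.Level m)
    (hx : g + x.1.1 ∈ S.F n) (hy : g + y.1.1 ∈ S.F m) (e : S.incl n x = S.incl m y) :
    S.incl n (shift g x hx) = S.incl m (shift g y hy) := by
  obtain ⟨x', hx', e₁, e₂⟩ := S.exists_level_of_le (le_max_left n m) g x hx
  obtain ⟨y', hy', e₃, e₄⟩ := S.exists_level_of_le (le_max_right n m) g y hy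
  obtain rfl : x' = y' := S.incl_injective _ (by rw [e₁, e₃, e])
  rw [← e₂, ← e₄]

/-- The partial transformation `T_g`, defined on `X^g`. -/
noncomputable def partialMap (g : G) (p : S.domain g) : S.Space :=
  S.incl p.2.choose (shift g p.2.choose_spec.choose p.2.choose_spec.choose_spec.1)

theorem partialMap_eq {n : ℕ} (g : G) (x : S.Level n) (h : g + x.1.1 ∈ S.F n)
    (hp : S.incl n x ∈ S.domain g) :
    S.partialMap g ⟨S.incl n x, hp⟩ = S.incl n (shift g x h) :=
  S.shift_unique g _ _ _ h hp.choose_spec.choose_spec.2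

/-- The set `X^G` as a (topological and Borel) space of its own. -/
abbrev FullDomain : Type _ := S.fullDomain

theorem mem_domain {S : CFSequence G} (p : S.FullDomain) (g : G) : p.1 ∈ S.domain g :=
  Set.mem_iInter.1 p.2 g

/-- A point of `X^G` has a representation that serves two given group elements at once. -/
theorem exists_common_level (p : S.FullDomain) (g k : G) :
    ∃ (n : ℕ) (x : S.Level n) (_ : g + x.1.1 ∈ S.F n) (_ : k + x.1.1 ∈ S.F n),
      S.incl n x = p.1 := by
  obtain ⟨n, x, hx, ex⟩ := mem_domain p g
  obtain ⟨m, y, hy, ey⟩ := mem_domain p k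
  obtain ⟨x', hx', e₁, -⟩ := S.exists_level_of_le (le_max_left n m) g x hx
  obtain ⟨y', hy', e₃, -⟩ := S.exists_level_of_le (le_max_right n m) k y hy
  obtain rfl : x' = y' := S.incl_injective _ (by rw [e₁, e₃, ex, ey])
  exact ⟨_, x', hx', hy', by rw [e₁, ex]⟩

theorem partialMap_mem (g : G) (p : S.FullDomain) :
    S.partialMap g ⟨p.1, mem_domain p g⟩ ∈ S.fullDomain := by
  refine Set.mem_iInter.2 fun k => ?_
  obtain ⟨n, x, h₁, h₂, e⟩ := S.exists_common_level p g (k + g)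
  obtain ⟨p, hp⟩ := p
  subst e
  rw [S.partialMap_eq g x h₁]
  exact ⟨n, shift g x h₁, by simpa [shift, add_assoc] using h₂, rfl⟩

/-- The `(C,F)`-action `T` of `G` on `X^G`. -/
noncomputable instance : AddAction G S.FullDomain where
  vadd g p := ⟨S.partialMap g ⟨p.1, mem_domain p g⟩, S.partialMap_mem g p⟩
  zero_vadd p := by
    obtain ⟨n, x, h, -, e⟩ := S.exists_common_level p 0 0
    obtain ⟨p, hp⟩ := p
    subst e
    refine Subtype.ext ((S.partialMap_eq 0 x h _).trans (congrArg _ ?_))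
    exact Prod.ext (Subtype.ext (zero_add _)) rfl
  add_vadd g k p := by
    obtain ⟨n, x, h₁, h₂, e⟩ := S.exists_common_level p k (g + k)
    obtain ⟨p, hp⟩ := p
    subst e
    have h₃ : g + (shift k x h₁).1.1 ∈ S.F n := by simpa [shift, add_assoc] using h₂
    refine Subtype.ext ((S.partialMap_eq (g + k) x h₂ _).trans (Eq.symm ?_))
    have e₁ := S.partialMap_eq k x h₁ (mem_domain ⟨S.incl n x, hp⟩ k)
    have e₂ : ∀ (q : S.domain g), q.1 = S.incl n (shift k x h₁) →
        S.partialMap g q = S.incl n (shift (g + k) x h₂) := by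
      rintro ⟨q, hq⟩ rfl
      refine (S.partialMap_eq g _ h₃ hq).trans (congrArg _ ?_)
      exact Prod.ext (Subtype.ext (add_assoc _ _ _).symm) rfl
    exact e₂ _ e₁

/-- The image `T_g B` (that is, `T_g (B ∩ X^G)`) of a subset `B` of the `(C,F)`-space. -/
def translate (g : G) (B : Set S.Space) : Set S.Space :=
  Subtype.val '' ((fun p : S.FullDomain => g +ᵥ p) '' (Subtype.val ⁻¹' B))

/-- The `(C,F)`-measure as a measure on `X^G`. -/
noncomputable def domainMeasure : Measure S.FullDomain := S.measure.comap Subtype.val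

/-- The condition that for all `g` and `n > 0`, the proportion of `g + F_n + C_{n+1} + ⋯ + C_m`
that lies in `F_m` tends to `1` as `m → ∞`; it says that `T` is defined almost everywhere. -/
def DefinedAE [DecidableEq G] : Prop :=
  ∀ (g : G) (n : ℕ), 0 < n →
    Tendsto (fun m : ℕ =>
      (((({g} + S.F n + ∑ j ∈ Finset.Ioc n m, S.C j) ∩ S.F m).card : ℕ) : ℝ) /
        (((S.F n).card : ℝ) * ∏ j ∈ Finset.Ioc n m, ((S.C j).card : ℝ))) atTop (𝓝 1)

/-- The condition of large holes. -/
def LargeHoles [DecidableEq G] : Prop :=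
  ∀ g : G, ∀ᶠ n in atTop,
    ({g} + S.F n + S.F n - S.F n - S.F n) ∩ (S.C (n + 1) - S.C (n + 1)) = {0}

end CFSequence

/-- Weak rational ergodicity, along an increasing sequence `D` of finite subsets of `G`, of an
action of `G` on a `σ`-finite measure space: the action is measure preserving, ergodic and
conservative, and for some set `Y` of finite positive measure, with
`a_n(Y) = ∑_{g ∈ D_n} μ(Y ∩ T_g Y) / μ(Y)²`, the averages `a_n(Y)⁻¹ ∑_{g ∈ D_n} μ(A ∩ T_g B)`
tend to `μ(A) μ(B)` for all measurable `A, B ⊆ Y`. -/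
structure IsWeaklyRationallyErgodicAlong {G X : Type*} [AddCommGroup G] [MeasurableSpace X]
    [AddAction G X] (μ : Measure X) (D : ℕ → Finset G) : Prop where
  sigmaFinite : SigmaFinite μ
  measurable : ∀ g : G, Measurable fun x : X => g +ᵥ x
  /-- This includes the invariance of `μ`. -/
  ergodic : ErgodicVAdd G X μ
  conservative : ∀ A : Set X, MeasurableSet A → 0 < μ A → ∃ g : G, g ≠ 0 ∧ 0 < μ (A ∩ (g +ᵥ A))
  monotone : Monotone D
  exists_set : ∃ Y : Set X, MeasurableSet Y ∧ 0 < μ Y ∧ μ Y < ∞ ∧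
    ∀ A B : Set X, MeasurableSet A → MeasurableSet B → A ⊆ Y → B ⊆ Y →
      Tendsto (fun n => 1 / (∑ g ∈ D n, μ.real (Y ∩ (g +ᵥ Y)) / μ.real Y ^ 2) *
        ∑ g ∈ D n, μ.real (A ∩ (g +ᵥ B))) atTop (𝓝 (μ.real A * μ.real B))

/-! The point is an exact identity. Write w_m = (#C_1 ⋯ #C_m)⁻¹ for the measure of each cylinder
[f]_m, f ∈ F_m. For large m, let g ∈ F_m - F_m and suppose that T_g takes a point of [f]_m into
[f']_m. At a high enough level T_g adds g to the address of the point. Descending one level at a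
time, the large holes condition (its case g = 0 suffices) forces the two points to have the same
C-coordinate, so that f' = g + f (`eq_add_of_mem_cell`). Hence A ∩ T_g[f]_m = A ∩ [g + f]_m for A ⊆
X_m. As g runs over F_m - F_m, the elements g + f exhaust F_m, and the sets A ∩ T_g[f]_m partition A
up to empty pieces. Cutting a cylinder B of level at most m into cylinders of level m gives ∑ μ(A ∩
T_g B) · w_m = μ(A) μ(B), with no error term (`sum_measure_inter_vadd_cell`).

In particular the denominator of the theorem is 1 / w_m. Borel sets B are reached by a π-λ argument
in `tendsto_correlationSum`: the sum of correlations is symmetric in A and B, so the identity with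
the cylinder [0]_0 in place of A bounds it by μ(B) / w_m, and dominated convergence handles
countable disjoint unions.

Invariance, ergodicity and conservativity rest on the fact that T permutes the cylinders [f]_m of a
level by translation wherever both indices lie in F_m. -/

namespace Letter

variable {G : Type*} (A : Finset G)

instance : DiscreteMeasurableSpace (Letter A) := ⟨fun _ => trivial⟩

instance : BorelSpace (Letter A) := ⟨(borel_eq_top_of_discrete).symm⟩

end Letter

namespace CFSequence

variable {G : Type*} [AddCommGroup G] (S : CFSequence G)

/-! ### Addresses and cylinders -/

/-- The translates of F_m by the elements of C_{m+1} are disjoint, so an address in F_{m+1}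
determines its last summand, and descent recovers all the coordinates up to m. -/
theorem address_eq_iff {n m : ℕ} (h : n ≤ m) (x y : S.Level n) :
    S.address ⟨n, x⟩ m = S.address ⟨n, y⟩ m ↔
      x.1 = y.1 ∧ ∀ j : Set.Ioi n, j.1 ≤ m → x.2 j = y.2 j := by
  induction m, h using Nat.le_induction with
  | base =>
    rw [address_self, address_self]
    exact ⟨fun e => ⟨Subtype.ext e, fun j hj => absurd j.2 (not_lt.2 hj)⟩,
      fun e => congrArg Subtype.val e.1⟩
  | succ m h ih =>
    have hm : n < m + 1 := Nat.lt_succ_of_le h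
    rw [address_succ S x h, address_succ S y h]
    constructor
    · intro e
      have hc : (x.2 ⟨m + 1, hm⟩).1 = (y.2 ⟨m + 1, hm⟩).1 := by
        by_contra hne
        exact Set.disjoint_left.1 (S.disjoint_translates m _ (x.2 _).2 _ (y.2 _).2 hne)
          ⟨_, S.address_mem x h, rfl⟩ ⟨_, S.address_mem y h, e.symm⟩
      rw [hc] at e
      obtain ⟨h₁, h₂⟩ := ih.1 (add_right_cancel e)
      refine ⟨h₁, fun j hj => ?_⟩
      rcases Nat.le_succ_iff.1 hj with hj | hj
      · exact h₂ j hj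
      · obtain rfl : j = ⟨m + 1, hm⟩ := Subtype.ext hj
        exact Subtype.ext hc
    · rintro ⟨h₁, h₂⟩
      rw [ih.2 ⟨h₁, fun j hj => h₂ j (hj.trans (Nat.le_succ m))⟩, h₂ ⟨m + 1, hm⟩ le_rfl]

/-- The image in `X_m` of a point of `X_n`, for `n ≤ m`. -/
def lift {n m : ℕ} (h : n ≤ m) (x : S.Level n) : S.Level m :=
  (⟨S.address ⟨n, x⟩ m, S.address_mem x h⟩, fun j => x.2 ⟨j.1, h.trans_lt j.2⟩)

theorem incl_lift {n m : ℕ} (h : n ≤ m) (x : S.Level n) :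
    S.incl m (S.lift h x) = S.incl n x := by
  induction m, h using Nat.le_induction with
  | base =>
    have e : S.lift le_rfl x = x := Prod.ext (Subtype.ext (S.address_self n x)) rfl
    rw [e]
  | succ m h ih =>
    have e : S.lift (h.trans (Nat.le_succ m)) x = S.step m (S.lift h x) :=
      Prod.ext (Subtype.ext (S.address_succ x h)) rfl
    rw [e, incl_step, ih]

theorem exists_incl_eq (M : ℕ) (p : S.Space) : ∃ n ≥ M, ∃ x : S.Level n, S.incl n x = p := by
  obtain ⟨⟨n, x⟩, rfl⟩ := Quot.exists_rep p
  exact ⟨max n M, le_max_right _ _, S.lift (le_max_left _ _) x, S.incl_lift _ x⟩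

theorem incl_mem_cylinder {n : ℕ} {x : S.Level n} {A : Set G} :
    S.incl n x ∈ S.cylinder n A ↔ x.1.1 ∈ A := by
  constructor
  · rintro ⟨y, hy, e⟩
    exact S.incl_injective n e ▸ hy
  · exact fun h => ⟨x, h, rfl⟩

theorem incl_mem_cylinder_singleton {n m : ℕ} (h : n ≤ m) {x : S.Level n} {f : G} :
    S.incl n x ∈ S.cylinder m {f} ↔ S.address ⟨n, x⟩ m = f := by
  rw [← S.incl_lift h, incl_mem_cylinder]
  rfl

theorem mem_F_of_mem_cylinder {m : ℕ} {f : G} {p : S.Space} (h : p ∈ S.cylinder m {f}) :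
    f ∈ S.F m := by
  obtain ⟨x, hx, -⟩ := h
  exact (show x.1.1 = f from hx) ▸ x.1.2

theorem eq_of_mem_cylinder {m : ℕ} {f f' : G} {p : S.Space} (h : p ∈ S.cylinder m {f})
    (h' : p ∈ S.cylinder m {f'}) : f = f' := by
  obtain ⟨x, hx, rfl⟩ := h
  exact (show x.1.1 = f from hx) ▸ S.incl_mem_cylinder.1 h'

/-- A cylinder of level m fixes the coordinates up to m and leaves the tail free. Hence two
cylinders are nested or disjoint, which makes them a π-system. -/
theorem cylinder_subset_of_mem {k m : ℕ} (h : k ≤ m) {f f' : G} {p : S.Space}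
    (hp : p ∈ S.cylinder k {f}) (hp' : p ∈ S.cylinder m {f'}) :
    S.cylinder m {f'} ⊆ S.cylinder k {f} := by
  obtain ⟨x, hx, rfl⟩ := hp
  rw [incl_mem_cylinder_singleton S h] at hp'
  rintro _ ⟨z, hz, rfl⟩
  -- The coordinates of `x` up to m, followed by the tail of `z`.
  let w : S.Level k :=
    (x.1, fun j => if hj : j.1 ≤ m then x.2 j else z.2 ⟨j.1, not_le.1 hj⟩)
  have hw : S.address ⟨k, w⟩ m = f' :=
    ((S.address_eq_iff h w x).2 ⟨rfl, fun j hj => dif_pos hj⟩).trans hp'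
  refine ⟨w, hx, ?_⟩
  rw [← S.incl_lift h]
  refine congrArg _ (Prod.ext (Subtype.ext (hw.trans (Eq.symm hz))) (funext fun j => ?_))
  exact dif_neg (not_le.2 j.2)

theorem range_incl_subset {k m : ℕ} (h : k ≤ m) :
    Set.range (S.incl k) ⊆ Set.range (S.incl m) := by
  rintro _ ⟨x, rfl⟩
  exact ⟨S.lift h x, S.incl_lift h x⟩

theorem range_incl (n : ℕ) : Set.range (S.incl n) = ⋃ f ∈ S.F n, S.cylinder n {f} := by
  ext p
  simp only [Set.mem_range, Set.mem_iUnion]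
  constructor
  · rintro ⟨x, rfl⟩
    exact ⟨x.1.1, x.1.2, S.incl_mem_cylinder.2 rfl⟩
  · rintro ⟨f, -, x, -, e⟩
    exact ⟨x, e⟩

theorem cylinder_zero : S.cylinder 0 {0} = Set.range (S.incl 0) := by
  simp [range_incl, F_zero]

theorem cylinder_subset_range (n : ℕ) (f : G) : S.cylinder n {f} ⊆ Set.range (S.incl n) := by
  rintro _ ⟨x, -, rfl⟩
  exact ⟨x, rfl⟩

theorem add_address_mem {n m : ℕ} (h : n ≤ m) (g : G) (x : S.Level n)
    (hx : g + x.1.1 ∈ S.F n) : g + S.address ⟨n, x⟩ m ∈ S.F m := by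
  obtain ⟨y, hy, e, -⟩ := S.exists_level_of_le h g x hx
  rw [← S.incl_lift h] at e
  rw [S.incl_injective _ e] at hy
  exact hy

theorem incl_mem_domain_iff {n : ℕ} {g : G} {x : S.Level n} :
    S.incl n x ∈ S.domain g ↔ ∃ m ≥ n, g + S.address ⟨n, x⟩ m ∈ S.F m := by
  constructor
  · rintro ⟨k, y, hy, e⟩
    obtain ⟨z, hz, ez, -⟩ := S.exists_level_of_le (le_max_left k n) g y hy
    rw [e, ← S.incl_lift (le_max_right k n)] at ez
    rw [S.incl_injective _ ez] at hz
    exact ⟨_, le_max_right k n, hz⟩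
  · rintro ⟨m, hm, h⟩
    exact ⟨m, S.lift hm x, h, S.incl_lift hm x⟩

theorem domain_zero : S.domain 0 = Set.univ := by
  refine Set.eq_univ_of_forall fun p => ?_
  obtain ⟨n, -, x, rfl⟩ := S.exists_incl_eq 0 p
  exact ⟨n, x, by simpa using x.1.2, rfl⟩

theorem domain_eq (g : G) :
    S.domain g = ⋃ m, ⋃ f ∈ {f | f ∈ S.F m ∧ g + f ∈ S.F m}, S.cylinder m {f} := by
  ext p
  simp only [Set.mem_iUnion, Set.mem_ofPred_eq]
  constructor
  · rintro ⟨n, x, hx, rfl⟩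
    exact ⟨n, _, ⟨x.1.2, hx⟩, S.incl_mem_cylinder.2 rfl⟩
  · rintro ⟨n, f, ⟨-, hf⟩, x, hx, rfl⟩
    exact ⟨n, x, (show x.1.1 = f from hx) ▸ hf, rfl⟩

/-! ### The topology of the space -/

theorem continuous_incl (n : ℕ) : Continuous (S.incl n) :=
  (show Continuous (Quot.mk S.Glue) from continuous_quot_mk).comp continuous_sigmaMk

theorem measurable_incl (n : ℕ) : Measurable (S.incl n) := (S.continuous_incl n).measurable

theorem continuous_fst_lift {n m : ℕ} (h : n ≤ m) :
    Continuous fun x : S.Level n => (S.lift h x).1 := by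
  induction m, h using Nat.le_induction with
  | base =>
    have e : (fun x : S.Level n => (S.lift le_rfl x).1) = Prod.fst :=
      funext fun x => Subtype.ext (S.address_self n x)
    rw [e]
    exact continuous_fst
  | succ m h ih =>
    let φ : Letter (S.F m) × Letter (S.C (m + 1)) → Letter (S.F (m + 1)) :=
      fun p => ⟨p.1.1 + p.2.1, S.add_mem m _ p.1.2 _ p.2.2⟩
    have hφ : Continuous φ := continuous_of_discreteTopology
    have e : (fun x : S.Level n => (S.lift (h.trans (Nat.le_succ m)) x).1) =
        fun x => φ ((S.lift h x).1, x.2 ⟨m + 1, Nat.lt_succ_of_le h⟩) :=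
      funext fun x => Subtype.ext (S.address_succ x h)
    rw [e]
    exact hφ.comp (ih.prodMk ((continuous_apply _).comp continuous_snd))

/-- Openness in the inductive limit is tested on each X_k. For k ≤ m the address in F_m is
continuous; for k ≥ m nesting makes membership depend on the F_k-coordinate alone. -/
theorem isOpen_cylinder (m : ℕ) (f : G) : IsOpen (S.cylinder m {f}) := by
  have key : ∀ k, IsOpen (S.incl k ⁻¹' S.cylinder m {f}) := by
    intro k
    rcases le_total k m with h | h
    · have : S.incl k ⁻¹' S.cylinder m {f} =
          (fun x : S.Level k => (S.lift h x).1) ⁻¹' {a | a.1 = f} := by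
        ext x
        exact S.incl_mem_cylinder_singleton h
      rw [this]
      exact (isOpen_discrete _).preimage (S.continuous_fst_lift h)
    · have : S.incl k ⁻¹' S.cylinder m {f} =
          Prod.fst ⁻¹' {a | ∃ x : S.Level k, x.1 = a ∧ S.incl k x ∈ S.cylinder m {f}} := by
        ext x
        refine ⟨fun hx => ⟨x, rfl, hx⟩, ?_⟩
        rintro ⟨y, hy, hm⟩
        exact S.cylinder_subset_of_mem h hm (S.incl_mem_cylinder.2 rfl)
          (S.incl_mem_cylinder.2 (congrArg Subtype.val hy.symm))
      rw [this]
      exact (isOpen_discrete _).preimage continuous_fst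
  have : IsOpen (Quot.mk S.Glue ⁻¹' S.cylinder m {f}) := isOpen_sigma_iff.2 key
  exact isQuotientMap_quot_mk.isOpen_preimage.1 this

theorem measurableSet_cylinder (m : ℕ) (f : G) : MeasurableSet (S.cylinder m {f}) :=
  (S.isOpen_cylinder m f).measurableSet

theorem isOpen_domain (g : G) : IsOpen (S.domain g) := by
  rw [domain_eq]
  exact isOpen_iUnion fun _ => isOpen_biUnion fun _ _ => S.isOpen_cylinder _ _

theorem measurableSet_range_incl (n : ℕ) : MeasurableSet (Set.range (S.incl n)) := by
  rw [range_incl]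
  exact Finset.measurableSet_biUnion _ fun _ _ => S.measurableSet_cylinder _ _

theorem measurableSet_fullDomain [Countable G] : MeasurableSet S.fullDomain :=
  MeasurableSet.iInter fun g => (S.isOpen_domain g).measurableSet

/-- The cylinders `[f]_m` with `m ≥ M` and `g + f ∈ F_m` around a point of `X^g` are a
neighbourhood basis. -/
theorem exists_cylinder_subset {g : G} (M : ℕ) {p : S.Space} (hp : p ∈ S.domain g)
    {U : Set S.Space} (hU : IsOpen U) (hpU : p ∈ U) :
    ∃ m ≥ M, ∃ f ∈ S.F m, g + f ∈ S.F m ∧ p ∈ S.cylinder m {f} ∧ S.cylinder m {f} ⊆ U := by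
  obtain ⟨n, x, hx, rfl⟩ := hp
  have hV : IsOpen (S.incl n ⁻¹' U) := hU.preimage (S.continuous_incl n)
  obtain ⟨u, v, -, hv, hxu, hxv, huv⟩ := isOpen_prod_iff.1 hV x.1 x.2 hpU
  obtain ⟨I, t, ht, htv⟩ := isOpen_pi_iff.1 hv x.2 hxv
  -- The basic neighbourhood constrains no coordinate beyond K, so a cylinder of level at least K
  -- around the point fits into it.
  obtain ⟨K, hK⟩ := (I.image Subtype.val).bddAbove
  have hn : n ≤ max (max n K) M := (le_max_left n K).trans (le_max_left _ _)
  refine ⟨max (max n K) M, le_max_right _ _, S.address ⟨n, x⟩ _, S.address_mem x hn,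
    S.add_address_mem hn g x hx, (S.incl_mem_cylinder_singleton hn).2 rfl, ?_⟩
  intro q hq
  obtain ⟨y, hy, rfl⟩ := S.cylinder_subset_of_mem hn (S.incl_mem_cylinder.2 rfl)
    ((S.incl_mem_cylinder_singleton hn).2 rfl) hq
  obtain ⟨e₁, e₂⟩ := (S.address_eq_iff hn y x).1 ((S.incl_mem_cylinder_singleton hn).1 hq)
  refine huv (Set.mk_mem_prod (e₁ ▸ hxu) (htv fun i hi => ?_))
  rw [e₂ i ((hK (Finset.mem_image_of_mem _ hi)).trans
    ((le_max_right n K).trans (le_max_left _ _)))]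
  exact (ht i hi).2

/-! ### Cylinders as a generating π-system -/

section Cells

variable {Y : Type*} (φ : Y → S.Space) (g : G) (M : ℕ)

/-- The preimages under `φ` of the cylinders `[f]_m` with `m ≥ M` and `g + f ∈ F_m`. -/
def cells : Set (Set Y) :=
  {s | ∃ m ≥ M, ∃ f ∈ S.F m, g + f ∈ S.F m ∧ s = φ ⁻¹' S.cylinder m {f}}

theorem countable_cells : (S.cells φ g M).Countable := by
  have : S.cells φ g M ⊆ ⋃ m, (fun f => φ ⁻¹' S.cylinder m {f}) '' (S.F m : Set G) := by
    rintro _ ⟨m, -, f, hf, -, rfl⟩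
    exact Set.mem_iUnion.2 ⟨m, f, hf, rfl⟩
  exact (Set.countable_iUnion fun m => ((S.F m).finite_toSet.image _).countable).mono this

theorem isPiSystem_cells : IsPiSystem (S.cells φ g M) := by
  rintro _ ⟨m, hm, f, hf, hgf, rfl⟩ _ ⟨m', hm', f', hf', hgf', rfl⟩ ⟨y, hy, hy'⟩
  rcases le_total m m' with h | h
  · refine ⟨m', hm', f', hf', hgf', ?_⟩
    exact Set.inter_eq_right.2 (Set.preimage_mono (S.cylinder_subset_of_mem h hy hy'))
  · refine ⟨m, hm, f, hf, hgf, ?_⟩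
    exact Set.inter_eq_left.2 (Set.preimage_mono (S.cylinder_subset_of_mem h hy' hy))

variable {φ g}

theorem sUnion_cells (hd : ∀ y, φ y ∈ S.domain g) : ⋃₀ S.cells φ g M = Set.univ := by
  refine Set.eq_univ_of_forall fun y => ?_
  obtain ⟨m, hm, f, hf, hgf, hy, -⟩ :=
    S.exists_cylinder_subset M (hd y) isOpen_univ (Set.mem_univ _)
  exact ⟨_, ⟨m, hm, f, hf, hgf, rfl⟩, hy⟩

variable [TopologicalSpace Y] [MeasurableSpace Y] [BorelSpace Y]

theorem generateFrom_cells (hφ : IsInducing φ) (hd : ∀ y, φ y ∈ S.domain g) :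
    ‹MeasurableSpace Y› = MeasurableSpace.generateFrom (S.cells φ g M) := by
  have hb : TopologicalSpace.IsTopologicalBasis (S.cells φ g M) := by
    refine TopologicalSpace.isTopologicalBasis_of_isOpen_of_nhds ?_ ?_
    · rintro _ ⟨m, -, f, -, -, rfl⟩
      exact (S.isOpen_cylinder m f).preimage hφ.continuous
    · intro y U hy hU
      obtain ⟨V, hV, rfl⟩ := hφ.isOpen_iff.1 hU
      obtain ⟨m, hm, f, hf, hgf, hy', hs⟩ := S.exists_cylinder_subset M (hd y) hV hy
      exact ⟨_, ⟨m, hm, f, hf, hgf, rfl⟩, hy', Set.preimage_mono hs⟩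
  have := hb.secondCountableTopology (S.countable_cells φ g M)
  rw [← hb.borel_eq_generateFrom]
  exact BorelSpace.measurable_eq

/-- The restrictions on m and f leave only the cylinders whose measure is easily computed: those
which T_g translates, at levels above a given one. They still cover and generate. -/
theorem ext_of_cells (hφ : IsInducing φ) (hd : ∀ y, φ y ∈ S.domain g) {μ ν : Measure Y}
    (hfin : ∀ m ≥ M, ∀ f ∈ S.F m, g + f ∈ S.F m → μ (φ ⁻¹' S.cylinder m {f}) ≠ ∞)
    (h : ∀ m ≥ M, ∀ f ∈ S.F m, g + f ∈ S.F m →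
      μ (φ ⁻¹' S.cylinder m {f}) = ν (φ ⁻¹' S.cylinder m {f})) : μ = ν := by
  refine Measure.ext_of_generateFrom_of_cover_subset (S.generateFrom_cells M hφ hd)
    (S.isPiSystem_cells φ g M) subset_rfl (S.countable_cells φ g M) (S.sUnion_cells M hd) ?_ ?_
  · rintro _ ⟨m, hm, f, hf, hgf, rfl⟩
    exact hfin m hm f hf hgf
  · rintro _ ⟨m, hm, f, hf, hgf, rfl⟩
    exact h m hm f hf hgf

end Cells

end CFSequence

theorem Letter.uniformOn_univ_singleton {G : Type*} {A : Finset G} (a : Letter A) :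
    (ProbabilityTheory.uniformOn Set.univ : Measure (Letter A)) {a} = ((A.card : ℕ) : ℝ≥0∞)⁻¹ := by
  have : Fintype (Letter A) := Fintype.ofFinite _
  have hc : Fintype.card (Letter A) = A.card := by
    rw [← Nat.card_eq_fintype_card]
    exact Nat.card_eq_finsetCard A
  rw [ProbabilityTheory.uniformOn_univ, Measure.count_singleton, hc, one_div]

namespace CFSequence

variable {G : Type*} [AddCommGroup G] (S : CFSequence G)

instance (n : ℕ) (j : Set.Ioi n) : Nonempty (Letter (S.C j)) := by
  have hj : 0 < j.1 := (Nat.zero_le n).trans_lt j.2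
  obtain ⟨c, hc⟩ := Finset.card_pos.1 (zero_lt_one.trans (S.one_lt_card j hj))
  exact ⟨⟨c, hc⟩⟩

instance (n : ℕ) (j : Set.Ioi n) :
    IsProbabilityMeasure (ProbabilityTheory.uniformOn Set.univ : Measure (Letter (S.C j))) :=
  ProbabilityTheory.isProbabilityMeasure_uniformOn Set.finite_univ Set.univ_nonempty

/-! ### The measure of cylinders -/

/-- The measure `(#C_1 ⋯ #C_n)⁻¹` of each of the cylinders `[f]_n`. -/
noncomputable def weight (n : ℕ) : ℝ≥0∞ := (∏ j ∈ Finset.Icc 1 n, ((S.C j).card : ℝ≥0∞))⁻¹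

theorem weight_zero : S.weight 0 = 1 := by simp [weight]

theorem card_C_ne_zero {j : ℕ} (hj : 0 < j) : ((S.C j).card : ℝ≥0∞) ≠ 0 :=
  Nat.cast_ne_zero.2 (zero_lt_one.trans (S.one_lt_card j hj)).ne'

theorem weight_succ (n : ℕ) : S.weight (n + 1) = S.weight n * ((S.C (n + 1)).card : ℝ≥0∞)⁻¹ := by
  rw [weight, weight, Finset.prod_Icc_succ_top (Nat.le_add_left 1 n), ENNReal.mul_inv]
  · exact Or.inr (ENNReal.natCast_ne_top _)
  · exact Or.inr (S.card_C_ne_zero n.succ_pos)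

theorem weight_ne_top (n : ℕ) : S.weight n ≠ ∞ :=
  ENNReal.inv_ne_top.2 (Finset.prod_ne_zero_iff.2 fun _ hj =>
    S.card_C_ne_zero (Finset.mem_Icc.1 hj).1)

theorem weight_mul_prod_Ioc {n m : ℕ} (h : n ≤ m) :
    S.weight n * ∏ j ∈ Finset.Ioc n m, ((S.C j).card : ℝ≥0∞)⁻¹ = S.weight m := by
  induction m, h using Nat.le_induction with
  | base => simp
  | succ m h ih => rw [Finset.prod_Ioc_succ_top h, ← mul_assoc, ih, weight_succ]

/-- Serves conservativity: cylinders become arbitrarily small. -/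
theorem weight_le (n : ℕ) : S.weight n ≤ 2⁻¹ ^ n := by
  induction n with
  | zero => simp [weight_zero]
  | succ n ih =>
    rw [weight_succ, pow_succ]
    refine mul_le_mul' ih (ENNReal.inv_le_inv.2 ?_)
    exact_mod_cast S.one_lt_card (n + 1) n.succ_pos

theorem levelMeasure_cylinder {n m : ℕ} (h : n ≤ m) (x : S.Level n) :
    S.levelMeasure n (S.incl n ⁻¹' S.cylinder m {S.address ⟨n, x⟩ m}) = S.weight m := by
  let J : Finset (Set.Ioi n) := (Finset.Ioc n m).subtype (· ∈ Set.Ioi n)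
  have hset : S.incl n ⁻¹' S.cylinder m {S.address ⟨n, x⟩ m} =
      {x.1} ×ˢ (J : Set (Set.Ioi n)).pi (fun j => {x.2 j}) := by
    ext y
    rw [Set.mem_preimage, incl_mem_cylinder_singleton S h, address_eq_iff S h]
    refine and_congr Iff.rfl (forall_congr' fun j => ?_)
    have : j ∈ (J : Set (Set.Ioi n)) ↔ j.1 ≤ m := by
      have hj : n < j.1 := j.2
      simp [J, hj]
    rw [this]
    rfl
  have hprod : ∏ j ∈ J, (ProbabilityTheory.uniformOn Set.univ : Measure (Letter (S.C j))) {x.2 j} =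
      ∏ j ∈ Finset.Ioc n m, ((S.C j).card : ℝ≥0∞)⁻¹ := by
    simp only [Letter.uniformOn_univ_singleton]
    exact Finset.prod_subtype_of_mem (fun j => ((S.C j).card : ℝ≥0∞)⁻¹)
      fun j hj => (Finset.mem_Ioc.1 hj).1
  rw [hset, levelMeasure, Measure.smul_apply, Measure.prod_prod, Measure.count_singleton,
    Measure.infinitePi_pi _ (fun _ _ => MeasurableSet.of_discrete), hprod, one_mul, smul_eq_mul]
  exact S.weight_mul_prod_Ioc h

theorem map_levelMeasure_cylinder {n m : ℕ} (h : n ≤ m) (f : G)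
    [Decidable (∃ x : S.Level n, S.address ⟨n, x⟩ m = f)] :
    (S.levelMeasure n).map (S.incl n) (S.cylinder m {f}) =
      if ∃ x : S.Level n, S.address ⟨n, x⟩ m = f then S.weight m else 0 := by
  rw [Measure.map_apply (S.measurable_incl n) (S.measurableSet_cylinder m f)]
  split_ifs with hf
  · obtain ⟨x, rfl⟩ := hf
    exact S.levelMeasure_cylinder h x
  · convert measure_empty (μ := S.levelMeasure n)
    refine Set.eq_empty_of_forall_notMem fun x hx => hf ⟨x, ?_⟩
    exact (S.incl_mem_cylinder_singleton h).1 hx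

/-! ### Consistency of the measures on the levels -/

theorem restrict_map_levelMeasure_succ (n : ℕ) :
    ((S.levelMeasure (n + 1)).map (S.incl (n + 1))).restrict (Set.range (S.incl n)) =
      (S.levelMeasure n).map (S.incl n) := by
  classical
  have hle : n ≤ n + 1 := Nat.le_succ n
  have key : ∀ m ≥ n + 1, ∀ f ∈ S.F m,
      ((S.levelMeasure (n + 1)).map (S.incl (n + 1))).restrict (Set.range (S.incl n))
          (id ⁻¹' S.cylinder m {f}) =
        if ∃ x : S.Level n, S.address ⟨n, x⟩ m = f then S.weight m else 0 := by
    intro m hm f hf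
    rw [Set.preimage_id, Measure.restrict_apply (S.measurableSet_cylinder m f)]
    split_ifs with h
    · obtain ⟨x, rfl⟩ := h
      have hsub : S.cylinder m {S.address ⟨n, x⟩ m} ⊆ Set.range (S.incl n) :=
        (S.cylinder_subset_of_mem (hle.trans hm) (S.incl_mem_cylinder.2 rfl)
          ((S.incl_mem_cylinder_singleton (hle.trans hm)).2 rfl)).trans
          (S.cylinder_subset_range n x.1.1)
      rw [Set.inter_eq_left.2 hsub, map_levelMeasure_cylinder S hm, if_pos]
      exact ⟨S.step n x, S.address_step n x hm⟩
    · convert measure_empty (μ := (S.levelMeasure (n + 1)).map (S.incl (n + 1)))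
      refine Set.eq_empty_of_forall_notMem ?_
      rintro _ ⟨hp, x, rfl⟩
      exact h ⟨x, (S.incl_mem_cylinder_singleton (hle.trans hm)).1 hp⟩
  refine S.ext_of_cells (g := 0) (n + 1) Topology.IsInducing.id
    (fun y => S.domain_zero ▸ Set.mem_univ y) ?_ ?_
  · intro m hm f hf _
    rw [key m hm f hf]
    split_ifs
    exacts [S.weight_ne_top m, ENNReal.zero_ne_top]
  · intro m hm f hf _
    rw [key m hm f hf, Set.preimage_id, map_levelMeasure_cylinder S (hle.trans hm)]

theorem restrict_map_levelMeasure {n m : ℕ} (h : n ≤ m) :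
    ((S.levelMeasure m).map (S.incl m)).restrict (Set.range (S.incl n)) =
      (S.levelMeasure n).map (S.incl n) := by
  induction m, h using Nat.le_induction with
  | base =>
    rw [Measure.restrict_map (S.measurable_incl n) (S.measurableSet_range_incl n),
      Set.preimage_range, Measure.restrict_univ]
  | succ m h ih =>
    rw [← ih, ← restrict_map_levelMeasure_succ S m,
      Measure.restrict_restrict (S.measurableSet_range_incl n),
      Set.inter_eq_left.2 (S.range_incl_subset h)]

/-- On the k-th disjoint piece the measures from X_k and X_n agree, whichever of k and n is larger;
summation over k gives the claim. -/
theorem restrict_measure_range (n : ℕ) :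
    S.measure.restrict (Set.range (S.incl n)) = (S.levelMeasure n).map (S.incl n) := by
  ext s hs
  have hmono : Monotone fun k => Set.range (S.incl k) := fun _ _ h => S.range_incl_subset h
  have hms : ∀ k, MeasurableSet (disjointed (fun k => Set.range (S.incl k)) k) :=
    MeasurableSet.disjointed fun k => S.measurableSet_range_incl k
  have hu : ⋃ k, disjointed (fun k => Set.range (S.incl k)) k = Set.univ := by
    rw [iUnion_disjointed]
    refine Set.eq_univ_of_forall fun p => ?_
    obtain ⟨k, -, x, rfl⟩ := S.exists_incl_eq 0 p
    exact Set.mem_iUnion.2 ⟨k, x, rfl⟩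
  have hsn := hs.inter (S.measurableSet_range_incl n)
  rw [Measure.restrict_apply hs, measure, Measure.sum_apply _ hsn]
  have key : ∀ k, ((S.levelMeasure k).map (S.incl k)).restrict
      (disjointed (fun k => Set.range (S.incl k)) k) (s ∩ Set.range (S.incl n)) =
      ((S.levelMeasure n).map (S.incl n)) (s ∩ disjointed (fun k => Set.range (S.incl k)) k) := by
    intro k
    have hd := disjointed_subset (fun k => Set.range (S.incl k)) k
    rw [Measure.restrict_apply hsn]
    rcases le_total k n with h | h
    · rw [← S.restrict_map_levelMeasure h, Measure.restrict_apply (hsn.inter (hms k)),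
        Set.inter_assoc, Set.inter_assoc, Set.inter_eq_left.2 hd,
        Set.inter_eq_right.2 (hd.trans (hmono h))]
    · rw [← S.restrict_map_levelMeasure h, Measure.restrict_apply (hs.inter (hms k))]
      congr 1
      ext p
      simp only [Set.mem_inter_iff]
      tauto
  simp_rw [key]
  rw [← measure_iUnion, ← Set.inter_iUnion, hu, Set.inter_univ]
  · exact fun i j hij => ((disjoint_disjointed _ hij).mono Set.inter_subset_right
      Set.inter_subset_right)
  · exact fun k => hs.inter (hms k)

theorem measure_eq_of_subset_range {n : ℕ} {s : Set S.Space} (hs : MeasurableSet s)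
    (h : s ⊆ Set.range (S.incl n)) : S.measure s = S.levelMeasure n (S.incl n ⁻¹' s) := by
  rw [← Measure.map_apply (S.measurable_incl n) hs, ← restrict_measure_range,
    Measure.restrict_apply hs, Set.inter_eq_left.2 h]

theorem measure_cylinder {n : ℕ} {f : G} (hf : f ∈ S.F n) :
    S.measure (S.cylinder n {f}) = S.weight n := by
  have : Nonempty (S.Level n) := ⟨⟨f, hf⟩, fun j => Classical.arbitrary _⟩
  rw [S.measure_eq_of_subset_range (S.measurableSet_cylinder n f) (S.cylinder_subset_range n f)]
  have := S.levelMeasure_cylinder le_rfl (⟨⟨f, hf⟩, fun j => Classical.arbitrary _⟩ : S.Level n)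
  rwa [address_self] at this

theorem measure_biUnion_cylinder {n : ℕ} {A : Finset G} (hA : A ⊆ S.F n) :
    S.measure (⋃ f ∈ A, S.cylinder n {f}) = A.card * S.weight n := by
  rw [measure_biUnion_finset]
  · rw [Finset.sum_congr rfl fun f hf => S.measure_cylinder (hA hf), Finset.sum_const,
      nsmul_eq_mul]
  · exact fun f _ f' _ hne => Set.disjoint_left.2 fun p hp hp' => hne (S.eq_of_mem_cylinder hp hp')
  · exact fun f _ => S.measurableSet_cylinder n f

theorem measure_range_incl (n : ℕ) :
    S.measure (Set.range (S.incl n)) = (S.F n).card * S.weight n := by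
  rw [range_incl]
  exact S.measure_biUnion_cylinder subset_rfl

theorem measure_range_incl_ne_top (n : ℕ) : S.measure (Set.range (S.incl n)) ≠ ∞ := by
  rw [measure_range_incl]
  exact ENNReal.mul_ne_top (ENNReal.natCast_ne_top _) (S.weight_ne_top n)

theorem F_nonempty (n : ℕ) : (S.F n).Nonempty := by
  induction n with
  | zero => simp [S.F_zero]
  | succ n ih =>
    obtain ⟨f, hf⟩ := ih
    obtain ⟨c, hc⟩ := Finset.card_pos.1 (zero_lt_one.trans (S.one_lt_card (n + 1) n.succ_pos))
    exact ⟨_, S.add_mem n f hf c hc⟩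

/-! ### The set on which the action is defined has full measure -/

theorem exists_address_eq [DecidableEq G] {n m : ℕ} (h : n ≤ m) {a : G}
    (ha : a ∈ S.F n + ∑ j ∈ Finset.Ioc n m, S.C j) : ∃ x : S.Level n, S.address ⟨n, x⟩ m = a := by
  induction m, h using Nat.le_induction generalizing a with
  | base =>
    rw [Finset.Ioc_self, Finset.sum_empty, add_zero] at ha
    exact ⟨(⟨a, ha⟩, fun j => Classical.arbitrary _), S.address_self n _⟩
  | succ m h ih =>
    rw [Finset.sum_Ioc_succ_top h, ← add_assoc] at ha
    obtain ⟨b, hb, c, hc, rfl⟩ := Finset.mem_add.1 ha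
    obtain ⟨x, rfl⟩ := ih hb
    have hm : n < m + 1 := Nat.lt_succ_of_le h
    let y : S.Level n := (x.1, fun j => if e : j.1 = m + 1 then ⟨c, e ▸ hc⟩ else x.2 j)
    refine ⟨y, ?_⟩
    rw [address_succ S y h, (S.address_eq_iff h y x).2 ⟨rfl, fun j hj => dif_neg (by omega)⟩]
    simp [y]

/-- X_n is the union of the cylinders [a]_m with a ∈ F_n + C_{n+1} + ⋯ + C_m, and those with g + a ∈
F_m lie in X^g. The ratio in `DefinedAE` is the proportion of X_n that they fill, and it tends to 1.
-/
theorem measure_range_incl_le_inter_domain [DecidableEq G] (hS : S.DefinedAE) (g : G) {n : ℕ}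
    (hn : 0 < n) :
    S.measure (Set.range (S.incl n)) ≤ S.measure (Set.range (S.incl n) ∩ S.domain g) := by
  let N : ℕ → Finset G := fun m => ({g} + S.F n + ∑ j ∈ Finset.Ioc n m, S.C j) ∩ S.F m
  have hle : ∀ m ≥ n, ((N m).card : ℝ≥0∞) * S.weight m ≤
      S.measure (Set.range (S.incl n) ∩ S.domain g) := by
    intro m hm
    -- Translation by -g turns the elements counted in `DefinedAE` into the indices a of these
    -- cylinders.
    let A : Finset G := (N m).image (fun a => -g + a)
    have hA : ∀ a ∈ A, g + a ∈ S.F m ∧ ∃ x : S.Level n, S.address ⟨n, x⟩ m = a := by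
      intro a ha
      obtain ⟨b, hb, rfl⟩ := Finset.mem_image.1 ha
      obtain ⟨hb₁, hb₂⟩ := Finset.mem_inter.1 hb
      rw [add_assoc] at hb₁
      obtain ⟨g', hg', c, hc, rfl⟩ := Finset.mem_add.1 hb₁
      obtain rfl := Finset.mem_singleton.1 hg'
      rw [neg_add_cancel_left]
      exact ⟨hb₂, S.exists_address_eq hm hc⟩
    have hAF : A ⊆ S.F m := by
      intro a ha
      obtain ⟨x, rfl⟩ := (hA a ha).2
      exact S.address_mem x hm
    have hcard : A.card = (N m).card := Finset.card_image_of_injective _ (add_right_injective _)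
    rw [← hcard, ← S.measure_biUnion_cylinder hAF]
    refine measure_mono (Set.iUnion₂_subset fun a ha => ?_)
    obtain ⟨hga, x, rfl⟩ := hA a ha
    refine Set.subset_inter ?_ ?_
    · exact (S.cylinder_subset_of_mem hm (S.incl_mem_cylinder.2 rfl)
          ((S.incl_mem_cylinder_singleton hm).2 rfl)).trans
          (S.cylinder_subset_range n x.1.1)
    · rintro _ ⟨z, hz, rfl⟩
      exact ⟨m, z, (show z.1.1 = _ from hz) ▸ hga, rfl⟩
  have hlim := hS g n hn
  have hofReal := (ENNReal.continuous_ofReal.tendsto 1).comp hlim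
  have hconst := ENNReal.Tendsto.mul_const (b := S.measure (Set.range (S.incl n))) hofReal
    (Or.inr (S.measure_range_incl_ne_top n))
  rw [ENNReal.ofReal_one, one_mul] at hconst
  refine le_of_tendsto hconst ?_
  filter_upwards [eventually_ge_atTop n] with m hm
  refine le_trans (le_of_eq ?_) (hle m hm)
  have hF : ((S.F n).card : ℝ≥0∞) ≠ 0 := Nat.cast_ne_zero.2 (S.F_nonempty n).card_pos.ne'
  have hP : (∏ j ∈ Finset.Ioc n m, ((S.C j).card : ℝ)) ≠ 0 := by
    refine Finset.prod_ne_zero_iff.2 fun j hj => Nat.cast_ne_zero.2 ?_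
    have := S.one_lt_card j ((Nat.zero_le n).trans_lt (Finset.mem_Ioc.1 hj).1)
    omega
  have hP' : (0 : ℝ) < ∏ j ∈ Finset.Ioc n m, ((S.C j).card : ℝ) :=
    lt_of_le_of_ne (Finset.prod_nonneg fun _ _ => Nat.cast_nonneg _) hP.symm
  have hF' : (0 : ℝ) < (S.F n).card := Nat.cast_pos.2 (S.F_nonempty n).card_pos
  rw [Function.comp_apply, ENNReal.ofReal_div_of_pos (mul_pos hF' hP'), ENNReal.ofReal_natCast,
    ENNReal.ofReal_mul hF'.le, ENNReal.ofReal_natCast, ENNReal.ofReal_prod_of_nonneg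
      (fun _ _ => Nat.cast_nonneg _), measure_range_incl, ← S.weight_mul_prod_Ioc hm]
  simp only [ENNReal.ofReal_natCast]
  rw [div_eq_mul_inv, ENNReal.mul_inv (Or.inl hF) (Or.inl (ENNReal.natCast_ne_top _)),
    ENNReal.prod_inv_distrib]
  · change ((N m).card : ℝ≥0∞) * _ * _ = _
    calc _ = ((S.F n).card * ((S.F n).card : ℝ≥0∞)⁻¹) * (((N m).card : ℝ≥0∞) * (S.weight n *
        ∏ j ∈ Finset.Ioc n m, ((S.C j).card : ℝ≥0∞)⁻¹)) := by ring
      _ = _ := by rw [ENNReal.mul_inv_cancel hF (ENNReal.natCast_ne_top _), one_mul]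
  · exact fun _ _ _ _ _ => Or.inr (ENNReal.natCast_ne_top _)

theorem measure_compl_domain [DecidableEq G] (hS : S.DefinedAE) (g : G) :
    S.measure (S.domain g)ᶜ = 0 := by
  have hcov : (S.domain g)ᶜ ⊆ ⋃ n, Set.range (S.incl (n + 1)) \ S.domain g := by
    intro p hp
    obtain ⟨n, hn, x, rfl⟩ := S.exists_incl_eq 1 p
    obtain ⟨k, rfl⟩ : ∃ k, n = k + 1 := ⟨n - 1, by omega⟩
    exact Set.mem_iUnion.2 ⟨k, ⟨x, rfl⟩, hp⟩
  refine measure_mono_null hcov (measure_iUnion_null fun n => ?_)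
  have hms := (S.measurableSet_range_incl (n + 1)).inter (S.isOpen_domain g).measurableSet
  rw [← Set.sdiff_self_inter, measure_sdiff Set.inter_subset_left hms.nullMeasurableSet
    (measure_ne_top_of_subset Set.inter_subset_left (S.measure_range_incl_ne_top _))]
  exact tsub_eq_zero_of_le (S.measure_range_incl_le_inter_domain hS g n.succ_pos)

theorem measure_compl_fullDomain [Countable G] [DecidableEq G] (hS : S.DefinedAE) :
    S.measure S.fullDomainᶜ = 0 := by
  rw [fullDomain, Set.compl_iInter]
  exact measure_iUnion_null fun g => S.measure_compl_domain hS g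

/-! ### Cylinders in the domain of the action -/

/-- The trace on `X^G` of the cylinder `[f]_m`. -/
def cell (m : ℕ) (f : G) : Set S.FullDomain := Subtype.val ⁻¹' S.cylinder m {f}

/-- The trace on `X^G` of `X_m`. -/
def levelSet (m : ℕ) : Set S.FullDomain := Subtype.val ⁻¹' Set.range (S.incl m)

theorem measurableSet_cell (m : ℕ) (f : G) : MeasurableSet (S.cell m f) :=
  measurable_subtype_coe (S.measurableSet_cylinder m f)

theorem measurableSet_levelSet (m : ℕ) : MeasurableSet (S.levelSet m) :=
  measurable_subtype_coe (S.measurableSet_range_incl m)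

theorem levelSet_mono : Monotone S.levelSet :=
  fun _ _ h => Set.preimage_mono (S.range_incl_subset h)

theorem levelSet_eq (m : ℕ) : S.levelSet m = ⋃ f ∈ S.F m, S.cell m f := by
  rw [levelSet, range_incl]
  simp only [Set.preimage_iUnion]
  rfl

theorem levelSet_zero : S.levelSet 0 = S.cell 0 0 := by
  rw [levelSet, ← cylinder_zero]
  rfl

theorem iUnion_levelSet : ⋃ m, S.levelSet m = Set.univ := by
  refine Set.eq_univ_of_forall fun p => ?_
  obtain ⟨n, -, x, hx⟩ := S.exists_incl_eq 0 p.1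
  exact Set.mem_iUnion.2 ⟨n, x, hx⟩

theorem cell_subset_levelSet (m : ℕ) (f : G) : S.cell m f ⊆ S.levelSet m :=
  Set.preimage_mono (S.cylinder_subset_range m f)

theorem disjoint_cell (m : ℕ) {f f' : G} (h : f ≠ f') : Disjoint (S.cell m f) (S.cell m f') :=
  Set.disjoint_left.2 fun _ hp hp' => h (S.eq_of_mem_cylinder hp hp')

theorem cylinder_eq_biUnion {m : ℕ} {f : G} (hf : f ∈ S.F m) :
    S.cylinder m {f} = ⋃ c ∈ S.C (m + 1), S.cylinder (m + 1) {f + c} := by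
  ext p
  simp only [Set.mem_iUnion, exists_prop]
  constructor
  · rintro ⟨x, hx, rfl⟩
    refine ⟨_, (x.2 ⟨m + 1, Nat.lt_succ_self m⟩).2, ?_⟩
    rw [← incl_step, incl_mem_cylinder, ← (show x.1.1 = f from hx)]
    rfl
  · rintro ⟨c, hc, hp⟩
    -- The coordinates beyond m + 1 are immaterial: any point with these first two places [f +
    -- c]_{m+1} inside [f]_m.
    let x : S.Level m := (⟨f, hf⟩, fun j => if e : j.1 = m + 1 then ⟨c, e ▸ hc⟩ else
      Classical.arbitrary _)
    refine S.cylinder_subset_of_mem (p := S.incl m x) (Nat.le_succ m)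
      (S.incl_mem_cylinder.2 rfl) ?_ hp
    rw [← incl_step, incl_mem_cylinder]
    simp [step, x]

theorem cell_eq_biUnion {m : ℕ} {f : G} (hf : f ∈ S.F m) :
    S.cell m f = ⋃ c ∈ S.C (m + 1), S.cell (m + 1) (f + c) := by
  rw [cell, cylinder_eq_biUnion S hf]
  simp only [Set.preimage_iUnion]
  rfl

variable {S}

theorem vadd_mem_cell {m : ℕ} {f g : G} {p : S.FullDomain} (hp : p ∈ S.cell m f)
    (h : g + f ∈ S.F m) : g +ᵥ p ∈ S.cell m (g + f) := by
  obtain ⟨p, hp'⟩ := p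
  obtain ⟨x, hx, rfl⟩ := hp
  obtain rfl : x.1.1 = f := hx
  exact ⟨shift g x h, rfl, (S.partialMap_eq g x h (mem_domain ⟨_, hp'⟩ g)).symm⟩

variable (S)

theorem preimage_vadd_cell {m : ℕ} {f g : G} (hf : f ∈ S.F m) (h : -g + f ∈ S.F m) :
    (fun p : S.FullDomain => g +ᵥ p) ⁻¹' S.cell m f = S.cell m (-g + f) := by
  ext p
  constructor
  · intro hp
    simpa using vadd_mem_cell (S := S) (g := -g) hp h
  · intro hp
    simpa using vadd_mem_cell (g := g) hp (by simpa using hf)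

theorem vadd_cell {m : ℕ} {f g : G} (hf : f ∈ S.F m) (h : g + f ∈ S.F m) :
    g +ᵥ S.cell m f = S.cell m (g + f) := by
  have := S.preimage_vadd_cell (g := -g) hf (by simpa using h)
  rw [neg_neg] at this
  rw [← this, ← Set.preimage_vadd_neg]

theorem measurable_vadd (g : G) : Measurable fun p : S.FullDomain => g +ᵥ p := by
  -- The cylinders [f]_m with -g + f ∈ F_m are enough to generate, and T_g pulls each of them back
  -- to a cylinder.
  have hgen := S.generateFrom_cells 0 (φ := (Subtype.val : S.FullDomain → S.Space)) (g := -g)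
    Topology.IsInducing.subtypeVal fun p => mem_domain p (-g)
  refine Measurable.of_le_map (hgen.le.trans (MeasurableSpace.generateFrom_le ?_))
  rintro _ ⟨m, -, f, hf, hgf, rfl⟩
  change MeasurableSet ((fun p : S.FullDomain => g +ᵥ p) ⁻¹' S.cell m f)
  rw [S.preimage_vadd_cell hf hgf]
  exact S.measurableSet_cell m _

instance : MeasurableConstVAdd G S.FullDomain := ⟨S.measurable_vadd⟩

/-! ### The invariant measure on the domain of the action -/

section Invariance

variable [Countable G]

theorem domainMeasure_apply (s : Set S.FullDomain) :
    S.domainMeasure s = S.measure (Subtype.val '' s) :=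
  comap_subtype_coe_apply S.measurableSet_fullDomain _ _

theorem measure_real_inter_translate (A B : Set S.Space) (g : G) :
    S.measure.real (A ∩ S.translate g B) =
      S.domainMeasure.real (Subtype.val ⁻¹' A ∩ (g +ᵥ (Subtype.val ⁻¹' B : Set S.FullDomain))) := by
  rw [measureReal_def, measureReal_def, domainMeasure_apply, Set.image_preimage_inter]
  rfl

variable {S} [DecidableEq G]

theorem domainMeasure_preimage (hS : S.DefinedAE) (s : Set S.Space) :
    S.domainMeasure (Subtype.val ⁻¹' s) = S.measure s := by
  rw [domainMeasure_apply, Subtype.image_preimage_coe, Set.inter_comm]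
  exact measure_inter_conull (S.measure_compl_fullDomain hS)

theorem domainMeasure_cell (hS : S.DefinedAE) {m : ℕ} {f : G} (hf : f ∈ S.F m) :
    S.domainMeasure (S.cell m f) = S.weight m := by
  rw [cell, domainMeasure_preimage hS, S.measure_cylinder hf]

theorem domainMeasure_levelSet_ne_top (hS : S.DefinedAE) (m : ℕ) :
    S.domainMeasure (S.levelSet m) ≠ ∞ := by
  rw [levelSet, domainMeasure_preimage hS]
  exact S.measure_range_incl_ne_top m

theorem sigmaFinite_domainMeasure (hS : S.DefinedAE) : SigmaFinite S.domainMeasure :=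
  ⟨⟨{ set := S.levelSet
      set_mem := fun _ => trivial
      finite := fun m => (domainMeasure_levelSet_ne_top hS m).lt_top
      spanning := S.iUnion_levelSet }⟩⟩

theorem vaddInvariantMeasure_domainMeasure (hS : S.DefinedAE) :
    VAddInvariantMeasure G S.FullDomain S.domainMeasure := by
  refine ⟨fun g s hs => ?_⟩
  rw [← Measure.map_apply (S.measurable_vadd g) hs]
  congr 1
  have key : ∀ m ≥ 0, ∀ f ∈ S.F m, -g + f ∈ S.F m →
      S.domainMeasure.map (fun p => g +ᵥ p) (S.cell m f) = S.weight m := by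
    intro m _ f hf hgf
    rw [Measure.map_apply (S.measurable_vadd g) (S.measurableSet_cell m f),
      S.preimage_vadd_cell hf hgf, domainMeasure_cell hS hgf]
  refine S.ext_of_cells (g := -g) 0 Topology.IsInducing.subtypeVal
    (fun p => mem_domain p (-g)) ?_ ?_
  · exact fun m hm f hf hgf => (key m hm f hf hgf).trans_ne (S.weight_ne_top m)
  · exact fun m hm f hf hgf => (key m hm f hf hgf).trans (domainMeasure_cell hS hf).symm

/-! ### Ergodicity and conservativity -/

/-- An invariant set A meets all the cylinders of one level in equal measure, since translations
exchange them. So μ(A ∩ [f]_m) = d w_m with d = μ(A ∩ [0]_0), and μ restricted to A equals d μ.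
Evaluation on the complement of A gives d = 0 or a null complement; if d = 0, evaluation on A gives
μ(A) = 0. -/
theorem ergodic_domainMeasure (hS : S.DefinedAE) : ErgodicVAdd G S.FullDomain S.domainMeasure := by
  have := vaddInvariantMeasure_domainMeasure hS
  refine ⟨fun {A} hA hinv => ?_⟩
  have hshift : ∀ m, ∀ f ∈ S.F m, ∀ f' ∈ S.F m,
      S.domainMeasure (A ∩ S.cell m f) = S.domainMeasure (A ∩ S.cell m f') := by
    intro m f hf f' hf'
    rw [← measure_preimage_vadd S.domainMeasure (f' - f) (A ∩ S.cell m f'), Set.preimage_inter,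
      S.preimage_vadd_cell hf' (by simpa using hf)]
    have e : -(f' - f) + f' = f := by abel
    rw [e]
    exact (measure_congr ((hinv (f' - f)).inter (ae_eq_refl _))).symm
  set d := S.domainMeasure (A ∩ S.cell 0 0) with hd
  have hcell : ∀ m, ∀ f ∈ S.F m, S.domainMeasure (A ∩ S.cell m f) = d * S.weight m := by
    intro m
    induction m with
    | zero =>
      intro f hf
      rw [S.F_zero, Finset.mem_singleton] at hf
      rw [hf, weight_zero, mul_one]
    | succ m ih =>
      intro f hf
      obtain ⟨f₀, hf₀⟩ := S.F_nonempty m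
      have h₀ := ih f₀ hf₀
      rw [S.cell_eq_biUnion hf₀, Set.inter_iUnion₂, measure_biUnion_finset,
        Finset.sum_congr rfl fun c hc => hshift (m + 1) (f₀ + c) (S.add_mem m _ hf₀ _ hc) f hf,
        Finset.sum_const, nsmul_eq_mul] at h₀
      · rw [weight_succ, ← mul_assoc, ← h₀, mul_comm, ← mul_assoc, ENNReal.inv_mul_cancel
          (S.card_C_ne_zero m.succ_pos) (ENNReal.natCast_ne_top _), one_mul]
      · intro c _ c' _ hne
        exact (S.disjoint_cell _ fun e => hne (add_left_cancel e)).mono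
          Set.inter_subset_right Set.inter_subset_right
      · exact fun c _ => hA.inter (S.measurableSet_cell _ _)
  have hr : S.domainMeasure.restrict A = d • S.domainMeasure := by
    have key : ∀ m ≥ 0, ∀ f ∈ S.F m, 0 + f ∈ S.F m →
        S.domainMeasure.restrict A (S.cell m f) = d * S.weight m := by
      intro m _ f hf _
      rw [Measure.restrict_apply (S.measurableSet_cell m f), Set.inter_comm, hcell m f hf]
    have hd' : d ≠ ∞ := by
      refine measure_ne_top_of_subset Set.inter_subset_right ?_
      rw [← levelSet_zero]
      exact domainMeasure_levelSet_ne_top hS 0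
    refine S.ext_of_cells (g := 0) 0 Topology.IsInducing.subtypeVal
      (fun p => mem_domain p 0) ?_ ?_
    · exact fun m hm f hf hgf => (key m hm f hf hgf).trans_ne
        (ENNReal.mul_ne_top hd' (S.weight_ne_top m))
    · refine fun m hm f hf hgf => (key m hm f hf hgf).trans ?_
      rw [Measure.smul_apply, smul_eq_mul]
      exact congrArg _ (domainMeasure_cell hS hf).symm
  rw [eventuallyConst_set', ae_eq_empty, ae_eq_univ]
  have h₁ := congrArg (fun ν : Measure S.FullDomain => ν Aᶜ) hr
  simp only [Measure.restrict_apply hA.compl, Set.compl_inter_self, measure_empty,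
    Measure.smul_apply, smul_eq_mul] at h₁
  rcases mul_eq_zero.1 h₁.symm with h | h
  · left
    have h₂ := congrArg (fun ν : Measure S.FullDomain => ν A) hr
    simpa [h] using h₂
  · exact Or.inr h

/-- If A met all its translates by g ≠ 0 in null sets, its pieces in the cylinders of level m could
be moved into a single cylinder with null overlaps. Then A ∩ X_n would have measure at most w_m for
all m ≥ n, hence zero. -/
theorem exists_measure_inter_vadd_pos (hS : S.DefinedAE) {A : Set S.FullDomain}
    (hA : MeasurableSet A) (hpos : 0 < S.domainMeasure A) :
    ∃ g : G, g ≠ 0 ∧ 0 < S.domainMeasure (A ∩ (g +ᵥ A)) := by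
  have := vaddInvariantMeasure_domainMeasure hS
  by_contra! hcon
  obtain ⟨n, hn⟩ : ∃ n, S.domainMeasure (A ∩ S.levelSet n) ≠ 0 := by
    by_contra! h
    refine hpos.ne' ?_
    rw [← Set.inter_univ A, ← S.iUnion_levelSet, Set.inter_iUnion]
    exact measure_iUnion_null h
  have hle : ∀ m ≥ n, S.domainMeasure (A ∩ S.levelSet n) ≤ S.weight m := by
    intro m hm
    obtain ⟨f₀, hf₀⟩ := S.F_nonempty m
    calc S.domainMeasure (A ∩ S.levelSet n) ≤ S.domainMeasure (A ∩ S.levelSet m) :=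
          measure_mono (Set.inter_subset_inter_right _ (S.levelSet_mono hm))
      _ ≤ ∑ f ∈ S.F m, S.domainMeasure (A ∩ S.cell m f) := by
          rw [levelSet_eq, Set.inter_iUnion₂]
          exact measure_biUnion_finset_le _ _
      _ = ∑ f ∈ S.F m, S.domainMeasure ((f₀ - f) +ᵥ (A ∩ S.cell m f)) := by
          simp only [measure_vadd]
      _ = S.domainMeasure (⋃ f ∈ S.F m, (f₀ - f) +ᵥ (A ∩ S.cell m f)) := by
          rw [measure_biUnion_finset₀]
          · intro f _ f' _ hne
            have h0 := hcon (f - f') (sub_ne_zero.2 hne)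
            refine measure_mono_null ?_ ((measure_vadd S.domainMeasure (f₀ - f) _).trans
              (le_antisymm h0 zero_le))
            rw [Set.vadd_set_inter, vadd_vadd]
            have e : f₀ - f + (f - f') = f₀ - f' := by abel
            rw [e]
            exact Set.inter_subset_inter (Set.vadd_set_mono Set.inter_subset_left)
              (Set.vadd_set_mono Set.inter_subset_left)
          · exact fun f _ => ((hA.inter (S.measurableSet_cell m f)).const_vadd _).nullMeasurableSet
      _ ≤ S.domainMeasure (S.cell m f₀) := by
          refine measure_mono (Set.iUnion₂_subset fun f hf => ?_)
          have e : f₀ - f + f = f₀ := by abel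
          have hv := S.vadd_cell (g := f₀ - f) hf (by rwa [e])
          rw [e] at hv
          rw [← hv]
          exact Set.vadd_set_mono Set.inter_subset_right
      _ = S.weight m := domainMeasure_cell hS hf₀
  have hlim : Tendsto (fun m : ℕ => (2⁻¹ : ℝ≥0∞) ^ m) atTop (𝓝 0) :=
    ENNReal.tendsto_pow_atTop_nhds_zero_of_lt_one (by simp)
  refine hn (le_antisymm (ge_of_tendsto hlim ?_) zero_le)
  filter_upwards [eventually_ge_atTop n] with m hm
  exact (hle m hm).trans (S.weight_le m)

end Invariance

end CFSequence

theorem MeasureTheory.hasSum_measureReal_iUnion {X : Type*} [MeasurableSpace X] {μ : Measure X}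
    {s : ℕ → Set X} (hs : ∀ i, MeasurableSet (s i)) (hd : Pairwise (Function.onFun Disjoint s))
    (hfin : μ (⋃ i, s i) ≠ ∞) : HasSum (fun i => μ.real (s i)) (μ.real (⋃ i, s i)) := by
  rw [measure_iUnion hd hs] at hfin
  rw [measureReal_def, measure_iUnion hd hs,
    ENNReal.tsum_toReal_eq (ENNReal.ne_top_of_tsum_ne_top hfin)]
  exact (ENNReal.summable_toReal hfin).hasSum

namespace CFSequence

variable {G : Type*} [AddCommGroup G] (S : CFSequence G)

/-! ### Large holes -/

theorem monotone_F_sub_F [DecidableEq G] : Monotone fun n => S.F n - S.F n := by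
  refine monotone_nat_of_le_succ fun n g hg => ?_
  obtain ⟨a, ha, b, hb, rfl⟩ := Finset.mem_sub.1 hg
  obtain ⟨c, hc⟩ := Finset.card_pos.1 (zero_lt_one.trans (S.one_lt_card (n + 1) n.succ_pos))
  exact Finset.mem_sub.2 ⟨_, S.add_mem n a ha c hc, _, S.add_mem n b hb c hc, by abel⟩

variable {S}

/-- If the addresses at level k + 1 differ by g, then c' - c is g plus a difference of two elements
of F_k. As g ∈ F_m - F_m ⊆ F_k - F_k, this lies in F_k + F_k - F_k - F_k, so the hole gives c' = c
and the addresses at level k differ by g too. -/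
theorem eq_add_of_mem_cell [DecidableEq G] {m : ℕ}
    (hm : ∀ k ≥ m, ({0} + S.F k + S.F k - S.F k - S.F k) ∩ (S.C (k + 1) - S.C (k + 1)) = {0})
    {g : G} (hg : g ∈ S.F m - S.F m) {f f' : G} {p : S.FullDomain} (hp : p ∈ S.cell m f)
    (hp' : g +ᵥ p ∈ S.cell m f') : f' = g + f := by
  obtain ⟨p, hpD⟩ := p
  obtain ⟨x, hx, rfl⟩ := hp
  obtain ⟨y, hy, ey⟩ := hp'
  obtain ⟨N, hN, hgN⟩ := S.incl_mem_domain_iff.1 (mem_domain ⟨S.incl m x, hpD⟩ g)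
  obtain rfl : x.1.1 = f := hx
  obtain rfl : y.1.1 = f' := hy
  have hxN : S.incl m x ∈ S.cylinder N {S.address ⟨m, x⟩ N} :=
    (S.incl_mem_cylinder_singleton hN).2 rfl
  have hv := vadd_mem_cell (g := g) (p := ⟨S.incl m x, hpD⟩) hxN hgN
  have htop : S.address ⟨m, y⟩ N = g + S.address ⟨m, x⟩ N := by
    refine (S.incl_mem_cylinder_singleton hN).1 ?_
    rw [ey]
    exact hv
  have down : ∀ k, m ≤ k → S.address ⟨m, y⟩ (k + 1) = g + S.address ⟨m, x⟩ (k + 1) →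
      S.address ⟨m, y⟩ k = g + S.address ⟨m, x⟩ k := by
    intro k hk e
    rw [address_succ S x hk, address_succ S y hk] at e
    set c := x.2 ⟨k + 1, Nat.lt_succ_of_le hk⟩
    set c' := y.2 ⟨k + 1, Nat.lt_succ_of_le hk⟩
    obtain ⟨a, ha, b, hb, hab⟩ := Finset.mem_sub.1 (S.monotone_F_sub_F hk hg)
    have hmem : c'.1 - c.1 ∈
        ({0} + S.F k + S.F k - S.F k - S.F k) ∩ (S.C (k + 1) - S.C (k + 1)) := by
      refine Finset.mem_inter.2 ⟨?_, Finset.sub_mem_sub c'.2 c.2⟩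
      have e' : c'.1 - c.1 = 0 + a + S.address ⟨m, x⟩ k - b - S.address ⟨m, y⟩ k := by
        have h1 : c'.1 - c.1 = g + S.address ⟨m, x⟩ k - S.address ⟨m, y⟩ k := by
          rw [sub_eq_sub_iff_add_eq_add, add_comm c'.1, e]
          abel
        rw [h1, ← hab]
        abel
      rw [e']
      exact Finset.sub_mem_sub (Finset.sub_mem_sub (Finset.add_mem_add (Finset.add_mem_add
        (Finset.mem_singleton_self 0) ha) (S.address_mem x hk)) hb) (S.address_mem y hk)
    rw [hm k hk, Finset.mem_singleton, sub_eq_zero] at hmem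
    rw [hmem, ← add_assoc] at e
    exact add_right_cancel e
  have all : ∀ j k, m ≤ k → S.address ⟨m, y⟩ (k + j) = g + S.address ⟨m, x⟩ (k + j) →
      S.address ⟨m, y⟩ k = g + S.address ⟨m, x⟩ k := by
    intro j
    induction j with
    | zero => exact fun k _ e => e
    | succ j ih => exact fun k hk e => ih k hk (down (k + j) (by omega) e)
  have := all (N - m) m le_rfl (by rwa [Nat.add_sub_cancel' hN])
  rwa [address_self, address_self] at this

/-- If g + f is not in F_m, both sides are empty: T_g[f]_m then misses X_m altogether. -/
theorem inter_vadd_cell [DecidableEq G] {m : ℕ}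
    (hm : ∀ k ≥ m, ({0} + S.F k + S.F k - S.F k - S.F k) ∩ (S.C (k + 1) - S.C (k + 1)) = {0})
    {g : G} (hg : g ∈ S.F m - S.F m) {f : G} (hf : f ∈ S.F m) {A : Set S.FullDomain}
    (hA : A ⊆ S.levelSet m) : A ∩ (g +ᵥ S.cell m f) = A ∩ S.cell m (g + f) := by
  ext p
  refine and_congr_right fun hp => ⟨?_, fun h => ?_⟩
  · rintro ⟨q, hq, rfl⟩
    have hl := hA hp
    rw [levelSet_eq] at hl
    obtain ⟨f', -, hf'⟩ := Set.mem_iUnion₂.1 hl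
    exact eq_add_of_mem_cell hm hg hq hf' ▸ hf'
  · rwa [S.vadd_cell hf (S.mem_F_of_mem_cylinder h)]

/-! ### Sums of correlations -/

section Correlation

variable (S) [DecidableEq G]

/-- The sum of the correlations `μ(A ∩ T_g B)` over `g ∈ F_m - F_m`. -/
noncomputable def correlationSum (m : ℕ) (A B : Set S.FullDomain) : ℝ :=
  ∑ g ∈ S.F m - S.F m, S.domainMeasure.real (A ∩ (g +ᵥ B))

variable {S}

theorem correlationSum_nonneg (m : ℕ) (A B : Set S.FullDomain) : 0 ≤ S.correlationSum m A B :=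
  Finset.sum_nonneg fun _ _ => measureReal_nonneg

variable [Countable G]

/-- [b]_k is a union of cylinders [f]_m, and each of them contributes exactly μ(A) to the sum. -/
theorem sum_measure_inter_vadd_cell (hS : S.DefinedAE) {m : ℕ}
    (hm : ∀ k ≥ m, ({0} + S.F k + S.F k - S.F k - S.F k) ∩ (S.C (k + 1) - S.C (k + 1)) = {0})
    {A : Set S.FullDomain} (hA : MeasurableSet A) (hAm : A ⊆ S.levelSet m) {k : ℕ} (hk : k ≤ m)
    (b : G) :
    (∑ g ∈ S.F m - S.F m, S.domainMeasure (A ∩ (g +ᵥ S.cell k b))) * S.weight m =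
      S.domainMeasure A * S.domainMeasure (S.cell k b) := by
  classical
  let Q : Finset G := {f ∈ S.F m | S.cylinder m {f} ⊆ S.cylinder k {b}}
  have hQF : ∀ f ∈ Q, f ∈ S.F m := fun f hf => (Finset.mem_filter.1 hf).1
  have hQ : S.cell k b = ⋃ f ∈ Q, S.cell m f := by
    ext p
    simp only [Set.mem_iUnion, exists_prop]
    constructor
    · intro hp
      have hl := S.levelSet_mono hk (S.cell_subset_levelSet k b hp)
      rw [levelSet_eq] at hl
      obtain ⟨f, hf, hpf⟩ := Set.mem_iUnion₂.1 hl
      exact ⟨f, Finset.mem_filter.2 ⟨hf, S.cylinder_subset_of_mem hk hp hpf⟩, hpf⟩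
    · rintro ⟨f, hf, hp⟩
      exact (Finset.mem_filter.1 hf).2 hp
  have hQμ : S.domainMeasure (S.cell k b) = Q.card * S.weight m := by
    rw [hQ, measure_biUnion_finset (fun f _ f' _ hne => S.disjoint_cell m hne)
      (fun f _ => S.measurableSet_cell m f),
      Finset.sum_congr rfl fun f hf => domainMeasure_cell hS (hQF f hf), Finset.sum_const,
      nsmul_eq_mul]
  have hsum : ∀ g ∈ S.F m - S.F m, S.domainMeasure (A ∩ (g +ᵥ S.cell k b)) =
      ∑ f ∈ Q, S.domainMeasure (A ∩ S.cell m (g + f)) := by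
    intro g hg
    rw [hQ, Set.vadd_set_iUnion₂, Set.inter_iUnion₂, Set.iUnion₂_congr fun f hf =>
      inter_vadd_cell hm hg (hQF f hf) hAm]
    refine measure_biUnion_finset (fun f _ f' _ hne => ?_)
      (fun f _ => hA.inter (S.measurableSet_cell m _))
    exact (S.disjoint_cell m fun e => hne (add_left_cancel e)).mono Set.inter_subset_right
      Set.inter_subset_right
  -- For fixed f, each f' ∈ F_m is g + f for the single g = f' - f, so A is covered exactly once.
  have hA' : ∀ f ∈ Q, ∑ g ∈ S.F m - S.F m, S.domainMeasure (A ∩ S.cell m (g + f)) =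
      S.domainMeasure A := by
    intro f hf
    rw [← measure_biUnion_finset (fun g _ g' _ hne => ?_)
      (fun g _ => hA.inter (S.measurableSet_cell m _)), ← Set.inter_iUnion₂]
    · congr 1
      refine Set.inter_eq_left.2 fun p hp => ?_
      have hl := hAm hp
      rw [levelSet_eq] at hl
      obtain ⟨f', hf', hpf⟩ := Set.mem_iUnion₂.1 hl
      refine Set.mem_iUnion₂.2 ⟨f' - f, Finset.sub_mem_sub hf' (hQF f hf), ?_⟩
      rwa [sub_add_cancel]
    · exact (S.disjoint_cell m fun e => hne (add_right_cancel e)).mono Set.inter_subset_right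
        Set.inter_subset_right
  rw [Finset.sum_congr rfl hsum, Finset.sum_comm, Finset.sum_congr rfl hA', Finset.sum_const,
    nsmul_eq_mul, hQμ]
  ring

theorem correlationSum_cell (hS : S.DefinedAE) {m : ℕ}
    (hm : ∀ k ≥ m, ({0} + S.F k + S.F k - S.F k - S.F k) ∩ (S.C (k + 1) - S.C (k + 1)) = {0})
    {A : Set S.FullDomain} (hA : MeasurableSet A) (hAm : A ⊆ S.levelSet m) {k : ℕ} (hk : k ≤ m)
    (b : G) :
    S.correlationSum m A (S.cell k b) * (S.weight m).toReal =
      S.domainMeasure.real A * S.domainMeasure.real (S.cell k b) := by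
  have h := congrArg ENNReal.toReal (sum_measure_inter_vadd_cell hS hm hA hAm hk b)
  rw [ENNReal.toReal_mul, ENNReal.toReal_mul, ENNReal.toReal_sum] at h
  · exact h
  · exact fun g _ => measure_ne_top_of_subset (Set.inter_subset_left.trans hAm)
      (domainMeasure_levelSet_ne_top hS m)

/-- F_m - F_m is symmetric and μ is invariant. -/
theorem correlationSum_comm (hS : S.DefinedAE) (m : ℕ) (A B : Set S.FullDomain) :
    S.correlationSum m A B = S.correlationSum m B A := by
  have := vaddInvariantMeasure_domainMeasure hS
  refine Finset.sum_equiv (Equiv.neg G) (fun _ => ?_) (fun g _ => ?_)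
  · rw [Equiv.neg_apply, ← Finset.mem_neg', neg_sub]
  · rw [measureReal_def, measureReal_def, ← measure_vadd S.domainMeasure (-g), Set.vadd_set_inter,
      neg_vadd_vadd, Set.inter_comm]
    rfl

theorem correlationSum_mono_left (hS : S.DefinedAE) (m : ℕ) {A A' : Set S.FullDomain} (h : A ⊆ A')
    {k : ℕ} (hA' : A' ⊆ S.levelSet k) (B : Set S.FullDomain) :
    S.correlationSum m A B ≤ S.correlationSum m A' B :=
  Finset.sum_le_sum fun _ _ => measureReal_mono (Set.inter_subset_inter_left _ h)
    (measure_ne_top_of_subset (Set.inter_subset_left.trans hA')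
      (domainMeasure_levelSet_ne_top hS k))

theorem correlationSum_diff (hS : S.DefinedAE) (m : ℕ) {k : ℕ} {A B B' : Set S.FullDomain}
    (hA : MeasurableSet A) (hAk : A ⊆ S.levelSet k) (hB : MeasurableSet B) (h : B ⊆ B') :
    S.correlationSum m A (B' \ B) = S.correlationSum m A B' - S.correlationSum m A B := by
  rw [correlationSum, correlationSum, correlationSum, ← Finset.sum_sub_distrib]
  refine Finset.sum_congr rfl fun g _ => ?_
  rw [Set.vadd_set_sdiff, Set.inter_sdiff_distrib_left]
  refine measureReal_sdiff (Set.inter_subset_inter_right _ (Set.vadd_set_mono h))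
    (hA.inter (hB.const_vadd g)) ?_
  exact measure_ne_top_of_subset (Set.inter_subset_left.trans hAk)
    (domainMeasure_levelSet_ne_top hS k)

theorem hasSum_correlationSum (hS : S.DefinedAE) (m : ℕ) {k : ℕ} {A : Set S.FullDomain}
    (hA : MeasurableSet A) (hAk : A ⊆ S.levelSet k) {B : ℕ → Set S.FullDomain}
    (hB : ∀ i, MeasurableSet (B i)) (hd : Pairwise (Function.onFun Disjoint B)) :
    HasSum (fun i => S.correlationSum m A (B i)) (S.correlationSum m A (⋃ i, B i)) := by
  refine hasSum_sum fun g _ => ?_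
  rw [Set.vadd_set_iUnion, Set.inter_iUnion]
  refine hasSum_measureReal_iUnion (fun i => hA.inter ((hB i).const_vadd g)) ?_ ?_
  · exact fun i j hij => (Set.disjoint_vadd_set.2 (hd hij)).mono
      Set.inter_subset_right Set.inter_subset_right
  · exact measure_ne_top_of_subset (Set.iUnion_subset fun i => Set.inter_subset_left.trans hAk)
      (domainMeasure_levelSet_ne_top hS k)

/-! ### From cylinders to Borel sets -/

theorem domainMeasure_real_cell_zero (hS : S.DefinedAE) :
    S.domainMeasure.real (S.cell 0 0) = 1 := by
  rw [measureReal_def, domainMeasure_cell hS (by simp [S.F_zero]), weight_zero, ENNReal.toReal_one]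

/-- B is cut down to [0]_0 inside the statement, so that the induction can pass through complements.
-/
theorem tendsto_correlationSum (hS : S.DefinedAE) (hholes : S.LargeHoles)
    {A : Set S.FullDomain} (hA : MeasurableSet A) (hA₀ : A ⊆ S.levelSet 0)
    {B : Set S.FullDomain} (hB : MeasurableSet B) :
    Tendsto (fun m => S.correlationSum m A (B ∩ S.levelSet 0) * (S.weight m).toReal) atTop
      (𝓝 (S.domainMeasure.real A * S.domainMeasure.real (B ∩ S.levelSet 0))) := by
  obtain ⟨n₀, hn₀⟩ := eventually_atTop.1 (hholes 0)
  have hlarge : ∀ m ≥ n₀, ∀ k ≥ m,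
      ({0} + S.F k + S.F k - S.F k - S.F k) ∩ (S.C (k + 1) - S.C (k + 1)) = {0} :=
    fun m hm k hk => hn₀ k (hm.trans hk)
  have hfin := domainMeasure_levelSet_ne_top hS 0
  have hAm : ∀ m, A ⊆ S.levelSet m := fun m => hA₀.trans (S.levelSet_mono (Nat.zero_le m))
  -- The domination: enlarge A to the cylinder [0]_0, exchange the two sets, and apply the exact
  -- identity.
  have hbound : ∀ m ≥ n₀, ∀ B : Set S.FullDomain, MeasurableSet B → B ⊆ S.levelSet 0 →
      S.correlationSum m A B * (S.weight m).toReal ≤ S.domainMeasure.real B := by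
    intro m hm B hB hB₀
    have h := correlationSum_cell hS (hlarge m hm) hB
      (hB₀.trans (S.levelSet_mono (Nat.zero_le m))) (Nat.zero_le m) 0
    rw [domainMeasure_real_cell_zero hS, mul_one, correlationSum_comm hS] at h
    rw [← h]
    refine mul_le_mul_of_nonneg_right ?_ ENNReal.toReal_nonneg
    exact correlationSum_mono_left hS m (hA₀.trans S.levelSet_zero.subset)
      (S.levelSet_zero.superset) B
  have hcell : ∀ k b, Tendsto
      (fun m => S.correlationSum m A (S.cell k b) * (S.weight m).toReal) atTop
      (𝓝 (S.domainMeasure.real A * S.domainMeasure.real (S.cell k b))) := by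
    intro k b
    refine tendsto_const_nhds.congr' ?_
    filter_upwards [eventually_ge_atTop n₀, eventually_ge_atTop k] with m hm hk
    exact (correlationSum_cell hS (hlarge m hm) hA (hAm m) hk b).symm
  have hempty : Tendsto (fun m => S.correlationSum m A (∅ ∩ S.levelSet 0) * (S.weight m).toReal)
      atTop (𝓝 (S.domainMeasure.real A * S.domainMeasure.real (∅ ∩ S.levelSet 0))) := by
    simp [correlationSum]
  induction B, hB using MeasurableSpace.induction_on_inter
    (S.generateFrom_cells 0 (g := 0) Topology.IsInducing.subtypeVal fun p => mem_domain p 0)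
    (S.isPiSystem_cells _ 0 0) with
  | empty => exact hempty
  | basic B hB =>
    obtain hemp | hne := (B ∩ S.levelSet 0).eq_empty_or_nonempty
    · rw [hemp]
      simpa using hempty
    · obtain ⟨m, -, f, -, -, e⟩ := S.isPiSystem_cells _ 0 0 B hB _
        ⟨0, le_rfl, 0, by simp [S.F_zero], by simp [S.F_zero], S.levelSet_zero⟩ hne
      rw [e]
      exact hcell m f
  | compl B hB ih =>
    have e : Bᶜ ∩ S.levelSet 0 = S.levelSet 0 \ (B ∩ S.levelSet 0) := by
      rw [Set.inter_comm, Set.sdiff_inter_self_eq_sdiff, Set.sdiff_eq]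
    have hm₀ := hB.inter (S.measurableSet_levelSet 0)
    rw [e, measureReal_sdiff Set.inter_subset_right hm₀ hfin, mul_sub]
    simp_rw [correlationSum_diff hS _ hA hA₀ hm₀ Set.inter_subset_right, sub_mul]
    refine Tendsto.sub ?_ ih
    rw [levelSet_zero]
    exact hcell 0 0
  | iUnion B hd hB ih =>
    have hm₀ : ∀ i, MeasurableSet (B i ∩ S.levelSet 0) :=
      fun i => (hB i).inter (S.measurableSet_levelSet 0)
    have hd₀ : Pairwise (Function.onFun Disjoint fun i => B i ∩ S.levelSet 0) :=
      fun i j hij => (hd hij).mono Set.inter_subset_left Set.inter_subset_left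
    have hsum := hasSum_measureReal_iUnion (μ := S.domainMeasure) hm₀ hd₀
      (measure_ne_top_of_subset (Set.iUnion_subset fun i => Set.inter_subset_right) hfin)
    rw [Set.iUnion_inter, ← (hsum.mul_left _).tsum_eq]
    have hΦ : ∀ m, S.correlationSum m A (⋃ i, B i ∩ S.levelSet 0) * (S.weight m).toReal =
        ∑' i, S.correlationSum m A (B i ∩ S.levelSet 0) * (S.weight m).toReal :=
      fun m => (((hasSum_correlationSum hS m hA hA₀ hm₀ hd₀).mul_right _).tsum_eq).symm
    simp_rw [hΦ]
    -- The dominating series is that of the measures of the disjoint pieces of [0]_0.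
    refine tendsto_tsum_of_dominated_convergence hsum.summable ih ?_
    filter_upwards [eventually_ge_atTop n₀] with m hm i
    rw [Real.norm_of_nonneg (mul_nonneg (correlationSum_nonneg m _ _) ENNReal.toReal_nonneg)]
    exact hbound m hm _ (hm₀ i) Set.inter_subset_right

theorem tendsto_correlationSum_div (hS : S.DefinedAE) (hholes : S.LargeHoles)
    {A B : Set S.FullDomain} (hA : MeasurableSet A) (hB : MeasurableSet B)
    (hA₀ : A ⊆ S.cell 0 0) (hB₀ : B ⊆ S.cell 0 0) :
    Tendsto (fun m => S.correlationSum m A B / S.correlationSum m (S.cell 0 0) (S.cell 0 0)) atTop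
      (𝓝 (S.domainMeasure.real A * S.domainMeasure.real B)) := by
  obtain ⟨n₀, hn₀⟩ := eventually_atTop.1 (hholes 0)
  have h := tendsto_correlationSum hS hholes hA (hA₀.trans S.levelSet_zero.superset) hB
  rw [levelSet_zero, Set.inter_eq_left.2 hB₀] at h
  refine h.congr' ?_
  filter_upwards [eventually_ge_atTop n₀] with m hm
  -- With both sets equal to [0]_0 the identity makes the denominator the inverse of w_m.
  have h₁ := correlationSum_cell hS (fun k hk => hn₀ k (hm.trans hk)) (S.measurableSet_cell 0 0)
    (S.levelSet_zero.superset.trans (S.levelSet_mono (Nat.zero_le m))) (Nat.zero_le m) 0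
  rw [domainMeasure_real_cell_zero hS, mul_one] at h₁
  rw [eq_inv_of_mul_eq_one_right h₁, div_eq_mul_inv]

theorem isWeaklyRationallyErgodicAlong_domainMeasure (hS : S.DefinedAE) (hholes : S.LargeHoles) :
    IsWeaklyRationallyErgodicAlong S.domainMeasure (fun n => S.F n - S.F n) where
  sigmaFinite := sigmaFinite_domainMeasure hS
  measurable := S.measurable_vadd
  ergodic := ergodic_domainMeasure hS
  conservative _ hA hpos := exists_measure_inter_vadd_pos hS hA hpos
  monotone := S.monotone_F_sub_F
  exists_set := by
    have hY : S.domainMeasure (S.cell 0 0) = 1 := by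
      rw [domainMeasure_cell hS (by simp [S.F_zero]), weight_zero]
    refine ⟨S.cell 0 0, S.measurableSet_cell 0 0, by simp [hY], by simp [hY], ?_⟩
    intro A B hA hB hA₀ hB₀
    refine (tendsto_correlationSum_div hS hholes hA hB hA₀ hB₀).congr fun m => ?_
    rw [domainMeasure_real_cell_zero hS, one_pow]
    simp only [div_one]
    rw [one_div_mul_eq_div]
    rfl

end Correlation

end CFSequence

theorem theorem2p8 {G : Type*} [AddCommGroup G] [Countable G] [DecidableEq G]
    (S : CFSequence G) (hS : S.DefinedAE) (hholes : S.LargeHoles) :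
    (∀ A B : Set S.Space, MeasurableSet A → MeasurableSet B →
      A ⊆ S.cylinder 0 {0} → B ⊆ S.cylinder 0 {0} →
      Tendsto (fun n =>
        (∑ g ∈ S.F n - S.F n, S.measure.real (A ∩ S.translate g B)) /
          ∑ g ∈ S.F n - S.F n,
            S.measure.real (S.cylinder 0 {0} ∩ S.translate g (S.cylinder 0 {0})))
        atTop (𝓝 (S.measure.real A * S.measure.real B))) ∧
    IsWeaklyRationallyErgodicAlong S.domainMeasure (fun n => S.F n - S.F n) := by
  refine ⟨fun A B hA hB hA₀ hB₀ => ?_,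
    CFSequence.isWeaklyRationallyErgodicAlong_domainMeasure hS hholes⟩
  -- Translates lie in X^G, so the correlations are already those of `domainMeasure`; the passage
  -- from X to X^G uses full measure only for μ(A) and μ(B).
  simp_rw [CFSequence.measure_real_inter_translate]
  rw [measureReal_def, measureReal_def, ← CFSequence.domainMeasure_preimage hS A,
    ← CFSequence.domainMeasure_preimage hS B]
  exact CFSequence.tendsto_correlationSum_div hS hholes (measurable_subtype_coe hA)
    (measurable_subtype_coe hB) (Set.preimage_mono hA₀) (Set.preimage_mono hB₀)
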